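/- Let $(\mathcal X,\mathcal B_{\mathcal X})$ and $(\mathcal Y,\mathcal B_{\mathcal Y})$ be measurable spaces with countably generated $\sigma$-algebras, and let $(X^t,Y^t)_{t\ge 0}$ be a time-homogeneous Markov chain on $\mathcal X\times\mathcal Y$ with the product $\sigma$-algebra. Write $\mathbf P_{x,y},\mathbf E_{x,y}$ for probability and expectation when $(X^0,Y^0)=(x,y)$. For a Markov chain $Z$ on a measurable space, call a measurable set $B$ *positive recurrent* if $\tau(B)=\min\{t\ge 1: Z^t\in B\}$ is $\mathbf P_z$-a.s. finite for every initial state $z$, and $\sup_{z\in B}\mathbf E_z\tau(B)<\infty$. Assume conditions A: - (A0) $\{X^t\}$ is itself a Markov chain, with autonomous dynamics: $\mathbf P_{x,y}(X^1\in\cdot)=\mathbf P_x(X^1\in\cdot)$ for all $x\in\mathcal X$, $y\in\mathcal Y$. - (A1) $\{X^t\}$ is aperiodic: there are no $d\ge 2$ and pairwise disjoint nonempty measurable sets $D_0,\dots,D_{d-1}$ with $\mathbf P_x(X^1\in D_{i+1 \bmod d})=1$ for all $i$ and all $x\in D_i$. - (A2) There is a set $V\in\mathcal B_{\mathcal X}$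 that is positive recurrent for $\{X^t\}$. - (A3) $V$ is petite: there are a number $0<p\le 1$, a probability measure $\mu$ on $\mathcal X$ and an integer $m\ge 1$ such that $\mathbf P_x(X^m\in\cdot)\ge p\,\mu(\cdot)$ for all $x\in V$. Under these conditions $\{X^t\}$ has a unique stationary distribution, denoted $\pi$. Let $L_2:\mathcal Y\to[0,\infty)$ be a measurable function that satisfies conditions B: - (B1) There is a constant $U<\infty$ with $\sup_{x\in\mathcal X,\,y\in\mathcal Y}\mathbf E_{x,y}\left|L_2(Y^1)-L_2(y)\right|\le U$. - (B2) There are a non-negative non-increasing function $h$ on $[0,\infty)$ with $h(N)\to 0$ as $N\to\infty$, and a measurable function $f:\mathcal X\to\mathbb R$, integrable with respect to $\pi$ with $\int_{\mathcal X} f\,d\pi<0$, such that $$\mathbf E_{x,y}\left(L_2(Y^1)-L_2(y)\right)\le f(x)+h(L_2(y))\qquad\text{for all } x\in\mathcal X,\ y\in\mathcal Y.$$ Then there exists $N_0$ such that the set $D=V\times\{y\in\mathcal Y: L_2(y)\le N_0\}$ is positive recurrent for the Markov chain $\{(X^t,Y^t)\}$. -/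

import Mathlib

open MeasureTheory ProbabilityTheory Filter Topology
open scoped ENNReal NNReal

/-- The law `P_x` on the path space `ℕ → S` of the time-homogeneous Markov chain with transition
kernel `κ` started at `x` (Ionescu-Tulcea). It is a kernel in the initial state `x`. -/
noncomputable def markovChainLaw {S : Type*} [MeasurableSpace S]
    (κ : Kernel S S) [IsMarkovKernel κ] : Kernel S (ℕ → S) :=
  (Kernel.traj (X := fun _ : ℕ => S)
      (fun n : ℕ => κ.comap
        (fun ω : (i : Finset.Iic n) → S => ω ⟨n, Finset.mem_Iic.2 le_rfl⟩)
        (measurable_pi_apply _)) 0).comap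
    (fun (x : S) (_ : Finset.Iic 0) => x) (measurable_pi_lambda _ fun _ => measurable_id)

/-- The first return time `τ(B) = min {t ≥ 1 : ω t ∈ B}` of a path `ω` to `B`;
it is `⊤` when there is no such `t`. -/
noncomputable def returnTime {S : Type*} (B : Set S) (ω : ℕ → S) : ℕ∞ :=
  ⨅ (t : ℕ) (_ : 1 ≤ t ∧ ω t ∈ B), (t : ℕ∞)

/-- A measurable set `B` is positive recurrent for the chain with kernel `κ`: from every initial
state, the return time to `B` is almost surely finite, and its mean is bounded uniformly over the
initial states in `B`. -/
structure IsPositiveRecurrentSet {S : Type*} [MeasurableSpace S]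
    (κ : Kernel S S) [IsMarkovKernel κ] (B : Set S) : Prop where
  measurableSet : MeasurableSet B
  ae_returnTime_lt_top : ∀ x : S, ∀ᵐ ω ∂(markovChainLaw κ x), returnTime B ω < ⊤
  iSup_lintegral_lt_top :
    (⨆ x ∈ B, ∫⁻ ω, (returnTime B ω : ℝ≥0∞) ∂(markovChainLaw κ x)) < ∞

/-- `V` admits a minorant measure: for some `0 < p ≤ 1`, some probability measure `μ` and some
`m ≥ 1`, `P_x (X^m ∈ ·) ≥ p μ(·)` for all `x ∈ V`. -/
def HasMinorant {S : Type*} [MeasurableSpace S] (κ : Kernel S S) (V : Set S) : Prop :=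
  ∃ (p : ℝ≥0) (μ : Measure S) (m : ℕ), 0 < p ∧ p ≤ 1 ∧ IsProbabilityMeasure μ ∧ 1 ≤ m ∧
    ∀ x ∈ V, p • μ ≤ (κ ^ m) x

/-- Aperiodicity: there is no cycle of length `d ≥ 2`, i.e. no `d` disjoint nonempty measurable
sets through which the chain moves cyclically with probability one. (The union of the sets of a
cycle is a nonempty absorbing set, so, for an irreducible chain, it automatically has full
measure for every irreducibility measure.) -/
def IsAperiodicKernel {S : Type*} [MeasurableSpace S] (κ : Kernel S S) : Prop :=
  ¬ ∃ (d : ℕ) (D : ZMod d → Set S), 2 ≤ d ∧ (∀ i, MeasurableSet (D i)) ∧ (∀ i, (D i).Nonempty) ∧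
    Pairwise (fun i j => Disjoint (D i) (D j)) ∧ ∀ i, ∀ x ∈ D i, κ x (D (i + 1)) = 1

/-! The path space enters only through the tails of the return time. It then suffices to find `G`
satisfying a state-dependent Foster criterion for `D`, since such a `G` dominates the mean return
time. The choice is `G = A·L₂(y) + C·w(x) + b₁·1_D`, where `w` is the mean return time of `X` to `V`
outside `V` and zero on `V`.

Off `V`, one step is taken: `w` drops by exactly 1 in mean and `L₂` rises by at most `U`, so `C = 1
+ A·U` pays for both the step and the rise. On `V` with `L₂` large, a fixed number `n` of steps is
taken: `L₂` drops by at least `n·c` in mean, and `A = 2/c` turns this into `2n`, half for the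
elapsed time and half for `C·E w(X^n) ≤ n`. On `D` the constant `b₁` absorbs everything.

Both estimates on `V` rest on `exists_invariant_uniform_average_le`: expected time averages of a
bounded function, started in `V`, are eventually below the stationary mean plus any error, uniformly
on `V`. Applied to `f` truncated at `U`, it gives the drop of `L₂`, because low values of `L₂`,
where `h` is not small, are rare by Markov's inequality. Applied to the mean return time on `V`,
with Kac's bound, it controls `E w(X^n)`.

The averaging theorem is proved by regeneration. The resolvent dominates `c • μ` on `V` in one step;
removing that part leaves a kernel `T`, and `μ ∑ T^j` is a finite invariant measure. Green
potentials of `T` solve a Poisson equation that compares sums of `ψ`, and of 1, with the number of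
visits to `V`. -/

/-! ### Return times through survival probabilities -/

section Survival

variable {S : Type*} [MeasurableSpace S]

/-- The probability that the chain with kernel `κ` started at `x` avoids `B` at times
`1, …, k`. -/
noncomputable def survival (κ : Kernel S S) (B : Set S) : ℕ → S → ℝ≥0∞
  | 0 => fun _ => 1
  | k + 1 => fun x => ∫⁻ z in Bᶜ, survival κ B k z ∂κ x

/-- The mean return time to `B`, as a function of the initial state. -/
noncomputable def meanReturn (κ : Kernel S S) (B : Set S) (x : S) : ℝ≥0∞ :=
  ∑' k, survival κ B k x

variable {κ : Kernel S S} {B : Set S}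

lemma measurable_setLIntegral_kernel (κ : Kernel S S) {A : Set S} (hA : MeasurableSet A)
    {g : S → ℝ≥0∞} (hg : Measurable g) : Measurable fun x => ∫⁻ z in A, g z ∂κ x := by
  simp_rw [← lintegral_indicator hA]
  exact (hg.indicator hA).lintegral_kernel

lemma measurable_survival (hB : MeasurableSet B) (k : ℕ) : Measurable (survival κ B k) := by
  induction k with
  | zero => exact measurable_const
  | succ k ih => exact measurable_setLIntegral_kernel κ hB.compl ih

lemma measurable_meanReturn (hB : MeasurableSet B) : Measurable (meanReturn κ B) :=
  Measurable.tsum fun k => measurable_survival hB k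

variable [IsMarkovKernel κ]

lemma survival_le_one (k : ℕ) (x : S) : survival κ B k x ≤ 1 := by
  induction k generalizing x with
  | zero => exact le_rfl
  | succ k ih =>
    calc ∫⁻ z in Bᶜ, survival κ B k z ∂κ x ≤ ∫⁻ z in Bᶜ, 1 ∂κ x := lintegral_mono ih
      _ ≤ ∫⁻ z, 1 ∂κ x := setLIntegral_le_lintegral _ _
      _ = 1 := by simp

lemma survival_succ_le (k : ℕ) (x : S) : survival κ B (k + 1) x ≤ survival κ B k x := by
  induction k generalizing x with
  | zero => exact survival_le_one 1 x
  | succ k ih => exact lintegral_mono ih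

lemma antitone_survival : Antitone (survival κ B) :=
  antitone_nat_of_succ_le fun k x => survival_succ_le k x

/-- The Markov property of the path law at a deterministic time. -/
lemma lintegral_markovChainLaw_succ (x : S) (n : ℕ)
    {F : ((i : Finset.Iic n) → S) → ℝ≥0∞} (hF : Measurable F)
    {g : S → ℝ≥0∞} (hg : Measurable g) :
    ∫⁻ ω, F (Preorder.frestrictLe n ω) * g (ω (n + 1)) ∂markovChainLaw κ x =
      ∫⁻ ω, F (Preorder.frestrictLe n ω) * ∫⁻ z, g z ∂κ (ω n) ∂markovChainLaw κ x := by
  set K : (n : ℕ) → Kernel ((i : Finset.Iic n) → S) S := fun n : ℕ => κ.comap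
        (fun ω : (i : Finset.Iic n) → S => ω ⟨n, Finset.mem_Iic.2 le_rfl⟩)
        (measurable_pi_apply _) with hK
  have hlaw : markovChainLaw κ x =
      Kernel.traj (X := fun _ : ℕ => S) K 0 (fun _ : Finset.Iic 0 => x) := by
    simp only [markovChainLaw, Kernel.comap_apply, hK]
  have hp := Kernel.partialTraj_compProd_eq_map_traj (X := fun _ : ℕ => S) (κ := K)
    (a := 0) (b := n) (Nat.zero_le n) (x₀ := fun _ : Finset.Iic 0 => x)
  have hm := Kernel.traj_map_frestrictLe_apply (X := fun _ : ℕ => S) (κ := K) 0 n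
    (fun _ : Finset.Iic 0 => x)
  have h1 : ∫⁻ ω, F (Preorder.frestrictLe n ω) * g (ω (n + 1)) ∂markovChainLaw κ x
      = ∫⁻ y, F y.1 * g y.2 ∂((markovChainLaw κ x).map
          (fun ω => (Preorder.frestrictLe n ω, ω (n + 1)))) := by
    rw [lintegral_map (f := fun y : ((i : Finset.Iic n) → S) × S => F y.1 * g y.2)]
    · fun_prop
    · exact (Preorder.measurable_frestrictLe (X := fun _ : ℕ => S) n).prodMk
        (measurable_pi_apply _)
  have hgK : Measurable fun y => ∫⁻ z, g z ∂(K n y) := hg.lintegral_kernel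
  rw [h1, hlaw, ← hp, Measure.lintegral_compProd (by fun_prop)]
  simp_rw [lintegral_const_mul _ hg]
  rw [← hm, lintegral_map (by fun_prop) (Preorder.measurable_frestrictLe n)]
  rfl

/-- Keeping `j` free makes the induction on `n` close: the Markov property at time `n` moves one
avoided step into the survival factor. The case `j = 0` gives the tail of the return time. -/
lemma setLIntegral_avoid_markovChainLaw (hB : MeasurableSet B) (n : ℕ) (x : S) (j : ℕ) :
    ∫⁻ ω, {ω : ℕ → S | ∀ i, 1 ≤ i → i ≤ n → ω i ∉ B}.indicator
      (fun ω => survival κ B j (ω n)) ω ∂markovChainLaw κ x = survival κ B (n + j) x := by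
  induction n generalizing j with
  | zero =>
    have hm := Kernel.traj_map_frestrictLe_apply (X := fun _ : ℕ => S)
      (κ := fun n : ℕ => κ.comap
        (fun ω : (i : Finset.Iic n) → S => ω ⟨n, Finset.mem_Iic.2 le_rfl⟩)
        (measurable_pi_apply _)) 0 0 (fun _ : Finset.Iic 0 => x)
    rw [Kernel.partialTraj_self, Kernel.id_apply] at hm
    have hs := (measurable_survival (κ := κ) hB j).comp
      (measurable_pi_apply (X := fun _ : Finset.Iic 0 => S) ⟨0, Finset.mem_Iic.2 le_rfl⟩)
    have h1 := lintegral_map (μ := markovChainLaw κ x) hs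
      (Preorder.measurable_frestrictLe (X := fun _ : ℕ => S) 0)
    have hlaw : (markovChainLaw κ x).map (Preorder.frestrictLe (π := fun _ : ℕ => S) 0) =
        Measure.dirac (fun _ : Finset.Iic 0 => x) := hm
    rw [hlaw, lintegral_dirac' _ hs] at h1
    rw [zero_add]
    refine Eq.trans (lintegral_congr fun ω => ?_) h1.symm
    rw [Set.indicator_of_mem]
    · rfl
    · intro i h1 h2
      omega
  | succ n ih =>
    have hA : MeasurableSet {y : (i : Finset.Iic n) → S | ∀ i : Finset.Iic n, 1 ≤ i.1 → y i ∉ B} := by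
      simp only [Set.ofPred_forall]
      exact MeasurableSet.iInter fun i => MeasurableSet.iInter fun _ =>
        hB.compl.preimage (measurable_pi_apply i)
    have key := lintegral_markovChainLaw_succ (κ := κ) x n
      (F := {y : (i : Finset.Iic n) → S | ∀ i : Finset.Iic n, 1 ≤ i.1 → y i ∉ B}.indicator 1)
      (measurable_one.indicator hA) (g := Bᶜ.indicator (survival κ B j))
      ((measurable_survival hB j).indicator hB.compl)
    have e : n + 1 + j = n + (j + 1) := by ring
    rw [e, ← ih (j + 1)]
    have h3 : ∀ ω : ℕ → S, Preorder.frestrictLe n ω ∈ {y : (i : Finset.Iic n) → S |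
        ∀ i : Finset.Iic n, 1 ≤ i.1 → y i ∉ B} ↔
        ω ∈ {ω : ℕ → S | ∀ i, 1 ≤ i → i ≤ n → ω i ∉ B} := fun ω =>
      ⟨fun h i h1 h2 => h ⟨i, Finset.mem_Iic.2 h2⟩ h1,
        fun h i h1 => h i h1 (Finset.mem_Iic.1 i.2)⟩
    have h4 : ∀ ω : ℕ → S, ω ∈ {ω : ℕ → S | ∀ i, 1 ≤ i → i ≤ n + 1 → ω i ∉ B} ↔
        ω ∈ {ω : ℕ → S | ∀ i, 1 ≤ i → i ≤ n → ω i ∉ B} ∧ ω (n + 1) ∉ B := by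
      refine fun ω => ⟨fun h => ⟨fun i h1 h2 => h i h1 (by omega), h _ (by omega) le_rfl⟩,
        fun h i h1 h2 => ?_⟩
      rcases h2.eq_or_lt with rfl | h2
      · exact h.2
      · exact h.1 i h1 (by omega)
    convert! key using 2
    · ext ω
      by_cases h1 : ω ∈ {ω : ℕ → S | ∀ i, 1 ≤ i → i ≤ n → ω i ∉ B}
      · rw [Set.indicator_of_mem ((h3 ω).2 h1)]
        by_cases h2 : ω (n + 1) ∈ B
        · rw [Set.indicator_of_notMem (fun h => ((h4 ω).1 h).2 h2),
            Set.indicator_of_notMem (by simpa using h2), mul_zero]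
        · rw [Set.indicator_of_mem ((h4 ω).2 ⟨h1, h2⟩), Set.indicator_of_mem (by simpa using h2)]
          simp
      · rw [Set.indicator_of_notMem (mt (h3 ω).1 h1),
          Set.indicator_of_notMem (fun h => h1 ((h4 ω).1 h).1), zero_mul]
    · ext ω
      rw [lintegral_indicator hB.compl]
      by_cases h1 : ω ∈ {ω : ℕ → S | ∀ i, 1 ≤ i → i ≤ n → ω i ∉ B}
      · rw [Set.indicator_of_mem ((h3 ω).2 h1), Set.indicator_of_mem h1]
        simp [survival]
      · rw [Set.indicator_of_notMem (mt (h3 ω).1 h1), Set.indicator_of_notMem h1, zero_mul]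

lemma setOf_lt_returnTime {S : Type*} (B : Set S) (k : ℕ) :
    {ω | (k : ℕ∞) < returnTime B ω} = {ω : ℕ → S | ∀ i, 1 ≤ i → i ≤ k → ω i ∉ B} := by
  ext ω
  simp only [returnTime, Set.mem_ofPred_eq]
  rw [← ENat.add_one_le_iff (ENat.natCast_ne_top k)]
  simp only [le_iInf_iff]
  constructor
  · intro h i h1 h2 h3
    have := h i ⟨h1, h3⟩
    norm_cast at this
    omega
  · intro h i hi
    by_contra hc
    refine h i hi.1 ?_ hi.2
    norm_cast at hc
    omega

lemma measurable_lt_returnTime (hB : MeasurableSet B) (k : ℕ) :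
    MeasurableSet {ω | (k : ℕ∞) < returnTime B ω} := by
  rw [setOf_lt_returnTime]
  simp only [Set.ofPred_forall]
  exact MeasurableSet.iInter fun i => MeasurableSet.iInter fun _ => MeasurableSet.iInter fun _ =>
    hB.compl.preimage (measurable_pi_apply i)

lemma markovChainLaw_lt_returnTime (hB : MeasurableSet B) (k : ℕ) (x : S) :
    markovChainLaw κ x {ω | (k : ℕ∞) < returnTime B ω} = survival κ B k x := by
  rw [← lintegral_indicator_one (measurable_lt_returnTime hB k), setOf_lt_returnTime]
  exact setLIntegral_avoid_markovChainLaw (κ := κ) hB k x 0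

lemma ENat.tsum_ite_lt (t : ℕ∞) : ∑' k : ℕ, (if (k : ℕ∞) < t then 1 else 0 : ℝ≥0∞) = t := by
  induction t using ENat.recTopCoe with
  | top => simp
  | coe n =>
    simp only [Nat.cast_lt, ENat.toENNReal_coe]
    rw [tsum_eq_sum (s := Finset.range n)]
    · rw [Finset.sum_congr rfl fun i hi => if_pos (Finset.mem_range.1 hi)]
      simp
    · intro b hb
      simpa using hb

lemma lintegral_returnTime (hB : MeasurableSet B) (x : S) :
    ∫⁻ ω, (returnTime B ω : ℝ≥0∞) ∂markovChainLaw κ x = meanReturn κ B x := by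
  simp_rw [← ENat.tsum_ite_lt, meanReturn, ← markovChainLaw_lt_returnTime hB]
  rw [lintegral_tsum]
  · refine tsum_congr fun k => ?_
    rw [← lintegral_indicator_one (measurable_lt_returnTime hB k)]
    refine lintegral_congr fun ω => ?_
    simp [Set.indicator]
  · intro k
    exact (Measurable.ite (measurable_lt_returnTime hB k) measurable_const
      measurable_const).aemeasurable

lemma ae_returnTime_lt_top_iff (hB : MeasurableSet B) (x : S) :
    (∀ᵐ ω ∂markovChainLaw κ x, returnTime B ω < ⊤) ↔ ⨅ k, survival κ B k x = 0 := by
  have hM : IsMarkovKernel (markovChainLaw κ) := by unfold markovChainLaw; infer_instance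
  simp_rw [ae_iff, ← markovChainLaw_lt_returnTime hB]
  rw [← Antitone.measure_iInter]
  · have : {a | ¬ returnTime B a < ⊤} = ⋂ k : ℕ, {ω | (k : ℕ∞) < returnTime B ω} := by
      ext ω
      simp only [not_lt, top_le_iff, Set.mem_ofPred_eq, Set.mem_iInter]
      exact ENat.eq_top_iff_forall_gt
    rw [this]
  · intro i j hij ω hω
    exact lt_of_le_of_lt (Nat.cast_le.2 hij) (Set.mem_ofPred_eq ▸ hω)
  · exact fun k => (measurable_lt_returnTime hB k).nullMeasurableSet
  · exact ⟨0, measure_ne_top _ _⟩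


/-- Eliminates path space: only `survival` and `meanReturn` matter afterwards. -/
lemma isPositiveRecurrentSet_iff :
    IsPositiveRecurrentSet κ B ↔ MeasurableSet B ∧ (∀ x, ⨅ k, survival κ B k x = 0) ∧
      ∃ b : ℝ≥0, ∀ x ∈ B, meanReturn κ B x ≤ b := by
  constructor
  · rintro ⟨h1, h2, h3⟩
    refine ⟨h1, fun x => (ae_returnTime_lt_top_iff h1 x).1 (h2 x), ?_⟩
    simp_rw [lintegral_returnTime h1] at h3
    refine ⟨(⨆ x ∈ B, meanReturn κ B x).toNNReal, fun x hx => ?_⟩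
    rw [ENNReal.coe_toNNReal h3.ne]
    exact le_iSup₂ (f := fun x (_ : x ∈ B) => meanReturn κ B x) x hx
  · rintro ⟨h1, h2, b, h3⟩
    refine ⟨h1, fun x => (ae_returnTime_lt_top_iff h1 x).2 (h2 x), ?_⟩
    simp_rw [lintegral_returnTime h1]
    exact (iSup₂_le h3).trans_lt ENNReal.coe_lt_top

end Survival

/-! ### Iterated kernels and drift inequalities -/

section Iterates

variable {S : Type*} [MeasurableSpace S]

lemma lintegral_kernel_pow_zero (κ : Kernel S S) {g : S → ℝ≥0∞} (hg : Measurable g) (x : S) :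
    ∫⁻ z, g z ∂(κ ^ 0) x = g x := by
  rw [pow_zero]
  exact Kernel.lintegral_id' hg x

lemma lintegral_kernel_pow_succ (κ : Kernel S S) (n : ℕ) {g : S → ℝ≥0∞} (hg : Measurable g)
    (x : S) : ∫⁻ z, g z ∂(κ ^ (n + 1)) x = ∫⁻ y, ∫⁻ z, g z ∂κ y ∂(κ ^ n) x := by
  rw [pow_succ']
  exact Kernel.lintegral_comp _ _ _ hg

lemma lintegral_kernel_pow_succ' (κ : Kernel S S) (n : ℕ) {g : S → ℝ≥0∞} (hg : Measurable g)
    (x : S) : ∫⁻ z, g z ∂(κ ^ (n + 1)) x = ∫⁻ y, ∫⁻ z, g z ∂(κ ^ n) y ∂κ x := by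
  rw [pow_succ]
  exact Kernel.lintegral_comp _ _ _ hg

instance isMarkovKernel_pow (κ : Kernel S S) [IsMarkovKernel κ] (n : ℕ) :
    IsMarkovKernel (κ ^ n) := by
  induction n with
  | zero => rw [pow_zero]; exact inferInstanceAs (IsMarkovKernel Kernel.id)
  | succ n ih => rw [pow_succ]; exact inferInstanceAs (IsMarkovKernel (Kernel.comp (κ ^ n) κ))

/-- The expected sum of `ψ` along the first `n` states of the chain. -/
noncomputable def expectedSum (κ : Kernel S S) (ψ : S → ℝ≥0∞) (n : ℕ) (x : S) : ℝ≥0∞ :=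
  ∑ t ∈ Finset.range n, ∫⁻ z, ψ z ∂(κ ^ t) x

variable {κ : Kernel S S} {g ψ ξ : S → ℝ≥0∞}

lemma expectedSum_mono (h : ∀ x, ψ x ≤ ξ x) (n : ℕ) (x : S) :
    expectedSum κ ψ n x ≤ expectedSum κ ξ n x :=
  Finset.sum_le_sum fun _ _ => lintegral_mono h

lemma expectedSum_const [IsMarkovKernel κ] (c : ℝ≥0∞) (n : ℕ) (x : S) :
    expectedSum κ (fun _ => c) n x = n * c := by
  simp [expectedSum]

lemma expectedSum_const_mul (hψ : Measurable ψ) (c : ℝ≥0∞) (n : ℕ) (x : S) :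
    expectedSum κ (fun z => c * ψ z) n x = c * expectedSum κ ψ n x := by
  simp_rw [expectedSum, lintegral_const_mul c hψ, Finset.mul_sum]

lemma expectedSum_add (hψ : Measurable ψ) (n : ℕ) (x : S) :
    expectedSum κ (fun z => ψ z + ξ z) n x = expectedSum κ ψ n x + expectedSum κ ξ n x := by
  simp_rw [expectedSum, lintegral_add_left hψ, Finset.sum_add_distrib]

/-- A Dynkin inequality. Gains and losses sit on opposite sides, so no subtraction in `ℝ≥0∞` and no
finiteness is needed. -/
lemma iterate_drift_le (hg : Measurable g) (hψ : Measurable ψ)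
    (h : ∀ x, ∫⁻ z, g z ∂κ x + ψ x ≤ g x + ξ x) (n : ℕ) (x : S) :
    ∫⁻ z, g z ∂(κ ^ n) x + expectedSum κ ψ n x ≤ g x + expectedSum κ ξ n x := by
  induction n with
  | zero => simp only [expectedSum, lintegral_kernel_pow_zero κ hg, Finset.range_zero,
      Finset.sum_empty, le_refl]
  | succ n ih =>
    simp only [expectedSum, Finset.sum_range_succ] at ih ⊢
    rw [lintegral_kernel_pow_succ κ n hg]
    calc _ = ∫⁻ y, (∫⁻ z, g z ∂κ y + ψ y) ∂(κ ^ n) x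
            + ∑ t ∈ Finset.range n, ∫⁻ z, ψ z ∂(κ ^ t) x := by
          rw [lintegral_add_right _ hψ]; ring
      _ ≤ ∫⁻ y, (g y + ξ y) ∂(κ ^ n) x + ∑ t ∈ Finset.range n, ∫⁻ z, ψ z ∂(κ ^ t) x := by
          exact add_le_add_left (lintegral_mono h) _
      _ = (∫⁻ y, g y ∂(κ ^ n) x + ∑ t ∈ Finset.range n, ∫⁻ z, ψ z ∂(κ ^ t) x)
            + ∫⁻ y, ξ y ∂(κ ^ n) x := by rw [lintegral_add_left hg]; ring
      _ ≤ _ := by rw [← add_assoc]; gcongr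

lemma le_iterate_drift (hg : Measurable g) (hψ : Measurable ψ)
    (h : ∀ x, g x + ξ x ≤ ∫⁻ z, g z ∂κ x + ψ x) (n : ℕ) (x : S) :
    g x + expectedSum κ ξ n x ≤ ∫⁻ z, g z ∂(κ ^ n) x + expectedSum κ ψ n x := by
  induction n with
  | zero => simp only [expectedSum, lintegral_kernel_pow_zero κ hg, Finset.range_zero,
      Finset.sum_empty, le_refl]
  | succ n ih =>
    simp only [expectedSum, Finset.sum_range_succ] at ih ⊢
    rw [lintegral_kernel_pow_succ κ n hg]
    calc _ ≤ (∫⁻ y, g y ∂(κ ^ n) x + ∑ t ∈ Finset.range n, ∫⁻ z, ψ z ∂(κ ^ t) x)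
            + ∫⁻ y, ξ y ∂(κ ^ n) x := by rw [← add_assoc]; gcongr
      _ = ∫⁻ y, (g y + ξ y) ∂(κ ^ n) x + ∑ t ∈ Finset.range n, ∫⁻ z, ψ z ∂(κ ^ t) x := by
          rw [lintegral_add_left hg]; ring
      _ ≤ ∫⁻ y, (∫⁻ z, g z ∂κ y + ψ y) ∂(κ ^ n) x
            + ∑ t ∈ Finset.range n, ∫⁻ z, ψ z ∂(κ ^ t) x := by
          exact add_le_add_left (lintegral_mono h) _
      _ = _ := by rw [lintegral_add_right _ hψ]; ring

end Iterates

/-! ### The state-dependent Foster criterion -/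

section Foster

variable {S : Type*} [MeasurableSpace S] {κ : Kernel S S} {B : Set S}

lemma sum_survival_succ (hB : MeasurableSet B) (k : ℕ) (x : S) :
    ∑ j ∈ Finset.range (k + 1), survival κ B j x =
      1 + ∫⁻ z in Bᶜ, ∑ j ∈ Finset.range k, survival κ B j z ∂κ x := by
  rw [Finset.sum_range_succ', add_comm, lintegral_finsetSum _ fun j _ => measurable_survival hB j]
  rfl

lemma meanReturn_eq (hB : MeasurableSet B) (x : S) :
    meanReturn κ B x = 1 + ∫⁻ z in Bᶜ, meanReturn κ B z ∂κ x := by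
  unfold meanReturn
  rw [tsum_eq_zero_add' ENNReal.summable,
    lintegral_tsum fun k => (measurable_survival hB k).aemeasurable]
  rfl

/-- Each of the first `n + 1` steps is charged in full, whether or not `B` was met before; only
killing at time `n + 1` is retained. -/
lemma sum_survival_le_iterate [IsMarkovKernel κ] (hB : MeasurableSet B) (k n : ℕ) (x : S) :
    ∑ j ∈ Finset.range (k + 1), survival κ B j x ≤
      (n + 1 : ℕ) + ∫⁻ z in Bᶜ, ∑ j ∈ Finset.range k, survival κ B j z ∂(κ ^ (n + 1)) x := by
  have hm : ∀ k, Measurable fun z => ∑ j ∈ Finset.range k, survival κ B j z := fun k =>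
    Finset.measurable_fun_sum _ fun j _ => measurable_survival hB j
  induction n with
  | zero => simpa using (sum_survival_succ hB k x).le
  | succ n ih =>
    have h1 : ∫⁻ z in Bᶜ, ∑ j ∈ Finset.range k, survival κ B j z ∂(κ ^ (n + 1)) x ≤
        ∫⁻ z, ∑ j ∈ Finset.range (k + 1), survival κ B j z ∂(κ ^ (n + 1)) x := by
      refine (setLIntegral_le_lintegral _ _).trans (lintegral_mono fun z => ?_)
      rw [Finset.sum_range_succ]
      exact le_self_add
    refine (ih.trans (add_le_add_right h1 _)).trans (le_of_eq ?_)
    simp_rw [sum_survival_succ hB k]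
    rw [lintegral_add_left measurable_const, ← lintegral_indicator hB.compl,
      lintegral_kernel_pow_succ κ (n + 1) ((hm k).indicator hB.compl)]
    simp_rw [lintegral_indicator hB.compl]
    simp only [lintegral_const, measure_univ, mul_one]
    push_cast
    ring

/-- The state-dependent Foster criterion: a nonnegative function that decreases in mean over a
state-dependent number of steps by at least that number of steps, up to killing on `B`, bounds the
mean return time to `B`. -/
theorem meanReturn_le_of_drift [IsMarkovKernel κ] (hB : MeasurableSet B) {G : S → ℝ≥0∞}
    (n : S → ℕ) (h : ∀ x, (n x + 1 : ℕ) + ∫⁻ z in Bᶜ, G z ∂(κ ^ (n x + 1)) x ≤ G x) (x : S) :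
    meanReturn κ B x ≤ G x := by
  have key : ∀ k x, ∑ j ∈ Finset.range k, survival κ B j x ≤ G x := by
    intro k
    induction k with
    | zero => simp
    | succ k ih =>
      intro x
      refine (sum_survival_le_iterate hB k (n x) x).trans (le_trans ?_ (h x))
      exact add_le_add_right (lintegral_mono ih) _
  rw [meanReturn, ENNReal.tsum_eq_iSup_nat]
  exact iSup_le fun k => key k x

lemma iInf_survival_eq_zero_of_meanReturn_ne_top {x : S} (h : meanReturn κ B x ≠ ∞) :
    ⨅ k, survival κ B k x = 0 := by
  by_contra hne
  refine h (top_le_iff.1 ?_)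
  calc ∞ = ∑' _ : ℕ, ⨅ k, survival κ B k x := (ENNReal.tsum_const_eq_top_of_ne_zero hne).symm
    _ ≤ meanReturn κ B x := ENNReal.tsum_le_tsum fun k => iInf_le _ k

lemma iInf_survival_le_setLIntegral [IsMarkovKernel κ] (hB : MeasurableSet B) (x : S) :
    ⨅ k, survival κ B k x ≤ ∫⁻ z in Bᶜ, ⨅ k, survival κ B k z ∂κ x := by
  rw [lintegral_iInf (measurable_survival hB) antitone_survival]
  · exact le_iInf fun k => iInf_le (fun k => survival κ B k x) (k + 1)
  · refine ne_top_of_le_ne_top ENNReal.one_ne_top ?_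
    exact survival_le_one 1 x

end Foster

/-! ### Potentials of a kernel -/

section Green

variable {S : Type*} [MeasurableSpace S]

/-- The potential kernel `∑ j, T ^ j` of a kernel `T`. -/
noncomputable def greenKernel (T : Kernel S S) : Kernel S S := Kernel.sum fun j : ℕ => T ^ j

lemma lintegral_greenKernel (T : Kernel S S) (ψ : S → ℝ≥0∞) (x : S) :
    ∫⁻ z, ψ z ∂greenKernel T x = ∑' j : ℕ, ∫⁻ z, ψ z ∂(T ^ j) x := by
  rw [greenKernel, Kernel.sum_apply, lintegral_sum_measure]

/-- Peels off the first step; the primed version peels off the last. -/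
lemma lintegral_greenKernel_eq (T : Kernel S S) {ψ : S → ℝ≥0∞} (hψ : Measurable ψ) (x : S) :
    ∫⁻ z, ψ z ∂greenKernel T x = ψ x + ∫⁻ y, ∫⁻ z, ψ z ∂greenKernel T y ∂T x := by
  simp_rw [lintegral_greenKernel]
  rw [tsum_eq_zero_add' ENNReal.summable, lintegral_kernel_pow_zero T hψ,
    lintegral_tsum fun j => hψ.lintegral_kernel.aemeasurable]
  simp_rw [lintegral_kernel_pow_succ' T _ hψ]

lemma lintegral_greenKernel_eq' (T : Kernel S S) {ψ : S → ℝ≥0∞} (hψ : Measurable ψ) (x : S) :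
    ∫⁻ z, ψ z ∂greenKernel T x = ψ x + ∫⁻ y, ∫⁻ z, ψ z ∂T y ∂greenKernel T x := by
  simp_rw [lintegral_greenKernel]
  rw [tsum_eq_zero_add' ENNReal.summable, lintegral_kernel_pow_zero T hψ]
  simp_rw [lintegral_kernel_pow_succ T _ hψ]

lemma lintegral_greenKernel_le (T : Kernel S S) {ψ W : S → ℝ≥0∞} (hψ : Measurable ψ)
    (hW : Measurable W) (h : ∀ x, ∫⁻ z, W z ∂T x + ψ x ≤ W x) (x : S) :
    ∫⁻ z, ψ z ∂greenKernel T x ≤ W x := by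
  rw [lintegral_greenKernel, ENNReal.tsum_eq_iSup_nat]
  refine iSup_le fun k => ?_
  have := iterate_drift_le (ξ := fun _ => 0) hW hψ (by simpa using h) k x
  simp only [expectedSum, lintegral_zero, Finset.sum_const_zero, add_zero] at this
  exact le_add_self.trans this

end Green

/-! ### The resolvent -/

section Resolvent

variable {S : Type*} [MeasurableSpace S]

/-- The resolvent `∑ k, 2 ^ (-(k + 1)) • κ ^ k`: the chain observed at a geometric time. -/
noncomputable def resolventKernel (κ : Kernel S S) : Kernel S S :=
  Kernel.sum fun k : ℕ =>
    ⟨fun x => (2⁻¹ : ℝ≥0∞) ^ (k + 1) • (κ ^ k) x,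
      Measure.measurable_of_measurable_coe _ fun _ hA =>
        ((κ ^ k).measurable_coe hA).const_mul ((2⁻¹ : ℝ≥0∞) ^ (k + 1))⟩

variable (κ : Kernel S S)

lemma lintegral_resolventKernel (ψ : S → ℝ≥0∞) (x : S) :
    ∫⁻ z, ψ z ∂resolventKernel κ x = ∑' k : ℕ, (2⁻¹ : ℝ≥0∞) ^ (k + 1) * ∫⁻ z, ψ z ∂(κ ^ k) x := by
  rw [resolventKernel, Kernel.sum_apply, lintegral_sum_measure]
  simp only [Kernel.coe_mk, lintegral_smul_measure, smul_eq_mul]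

instance [IsMarkovKernel κ] : IsMarkovKernel (resolventKernel κ) := by
  refine ⟨fun x => ⟨?_⟩⟩
  rw [← lintegral_one, lintegral_resolventKernel]
  simp [ENNReal.tsum_geometric_add_one, ENNReal.inv_mul_cancel]

/-- The geometric time is 0 with probability one half and otherwise one plus a copy of itself. This
identity carries results from the resolvent back to `κ`. -/
lemma two_mul_lintegral_resolventKernel {ψ : S → ℝ≥0∞} (hψ : Measurable ψ) (x : S) :
    2 * ∫⁻ z, ψ z ∂resolventKernel κ x =
      ψ x + ∫⁻ y, ∫⁻ z, ψ z ∂κ y ∂resolventKernel κ x := by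
  have h2 : (2 : ℝ≥0∞) * 2⁻¹ = 1 := ENNReal.mul_inv_cancel (by simp) (by simp)
  simp_rw [lintegral_resolventKernel]
  rw [tsum_eq_zero_add' ENNReal.summable, lintegral_kernel_pow_zero κ hψ, mul_add, ← mul_assoc,
    zero_add, pow_one, h2, one_mul, ← ENNReal.tsum_mul_left]
  congr 1
  refine tsum_congr fun k => ?_
  rw [lintegral_kernel_pow_succ κ _ hψ, pow_succ' _ (k + 1), mul_assoc, ← mul_assoc, h2, one_mul]

lemma lintegral_lintegral_resolventKernel_comm {ψ : S → ℝ≥0∞} (hψ : Measurable ψ) (x : S) :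
    ∫⁻ y, ∫⁻ z, ψ z ∂resolventKernel κ y ∂κ x = ∫⁻ y, ∫⁻ z, ψ z ∂κ y ∂resolventKernel κ x := by
  simp_rw [lintegral_resolventKernel]
  rw [lintegral_tsum fun k => (hψ.lintegral_kernel.const_mul _).aemeasurable]
  refine tsum_congr fun k => ?_
  rw [lintegral_const_mul _ hψ.lintegral_kernel, ← lintegral_kernel_pow_succ κ _ hψ,
    ← lintegral_kernel_pow_succ' κ _ hψ]

lemma smul_pow_le_resolventKernel (m : ℕ) (x : S) :
    (2⁻¹ : ℝ≥0∞) ^ (m + 1) • (κ ^ m) x ≤ resolventKernel κ x := by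
  rw [resolventKernel, Kernel.sum_apply]
  exact Measure.le_sum (fun k : ℕ => (2⁻¹ : ℝ≥0∞) ^ (k + 1) • (κ ^ k) x) m

/-- The geometric time may miss `V`; adding `b` on `Vᶜ` completes the resolvent mean of `b·1_V` to
the constant `b`. -/
lemma lintegral_resolventKernel_drift [IsMarkovKernel κ] {V : Set S} (hV : MeasurableSet V)
    {w : S → ℝ≥0∞} (hw : Measurable w) {b : ℝ≥0}
    (h : ∀ x, ∫⁻ z, w z ∂κ x + 1 ≤ w x + V.indicator (fun _ => (b : ℝ≥0∞)) x) (x : S) :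
    ∫⁻ z, (w z + Vᶜ.indicator (fun _ => (b : ℝ≥0∞)) z) ∂resolventKernel κ x + 1 ≤
      w x + b := by
  by_cases hwx : w x = ∞
  · simp [hwx]
  -- Needed for cancellation: the means of `w` grow at most linearly in `k`, and geometric weights
  -- sum that.
  have hK : ∫⁻ z, w z ∂resolventKernel κ x ≠ ∞ := by
    have hk : ∀ k : ℕ, ∫⁻ z, w z ∂(κ ^ k) x ≤ w x + k * b := fun k =>
      calc _ ≤ w x + expectedSum κ (V.indicator fun _ => (b : ℝ≥0∞)) k x :=
            le_self_add.trans (iterate_drift_le hw measurable_const h k x)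
        _ ≤ w x + expectedSum κ (fun _ => (b : ℝ≥0∞)) k x := by
            gcongr
            exact expectedSum_mono (fun z => Set.indicator_le_self' (fun _ _ => zero_le) z) k x
        _ = w x + k * b := by rw [expectedSum_const]
    have hsum : ∑' k : ℕ, (2⁻¹ : ℝ≥0∞) ^ (k + 1) * k ≠ ∞ := by
      have h1 : Summable fun k : ℕ => (2⁻¹ : ℝ≥0) ^ (k + 1) * k := by
        rw [← NNReal.summable_coe]
        have := (summable_pow_mul_geometric_of_norm_lt_one (R := ℝ) 1 (r := 2⁻¹)
          (by norm_num)).mul_left 2⁻¹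
        refine this.congr fun k => ?_
        push_cast
        ring
      convert! ENNReal.tsum_coe_ne_top_iff_summable.2 h1 using 3 with k
      push_cast
      simp
    rw [lintegral_resolventKernel]
    refine ne_top_of_le_ne_top ?_ (ENNReal.tsum_le_tsum fun k => mul_le_mul_right (hk k) _)
    simp_rw [mul_add, ← mul_assoc]
    rw [ENNReal.tsum_add, ENNReal.tsum_mul_right, ENNReal.tsum_mul_right]
    refine ENNReal.add_ne_top.2 ⟨ENNReal.mul_ne_top ?_ hwx,
      ENNReal.mul_ne_top hsum ENNReal.coe_ne_top⟩
    simp [ENNReal.tsum_geometric_add_one, ENNReal.inv_mul_cancel]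
  have h1 := two_mul_lintegral_resolventKernel κ hw x
  have h2 : ∫⁻ y, ∫⁻ z, w z ∂κ y ∂resolventKernel κ x + 1 ≤ ∫⁻ z, w z ∂resolventKernel κ x +
      ∫⁻ z, V.indicator (fun _ => (b : ℝ≥0∞)) z ∂resolventKernel κ x := by
    have := lintegral_mono (μ := resolventKernel κ x) h
    rw [lintegral_add_right _ measurable_const, lintegral_add_left hw] at this
    simpa using this
  have h3 : ∫⁻ z, V.indicator (fun _ => (b : ℝ≥0∞)) z ∂resolventKernel κ x +
      ∫⁻ z, Vᶜ.indicator (fun _ => (b : ℝ≥0∞)) z ∂resolventKernel κ x = b := by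
    rw [lintegral_indicator hV, lintegral_indicator hV.compl, lintegral_add_compl _ hV]
    simp
  rw [lintegral_add_left hw]
  refine (ENNReal.add_le_add_iff_left hK).1 ?_
  calc _ = 2 * ∫⁻ z, w z ∂resolventKernel κ x + 1 +
        ∫⁻ z, Vᶜ.indicator (fun _ => (b : ℝ≥0∞)) z ∂resolventKernel κ x := by ring
    _ = w x + (∫⁻ y, ∫⁻ z, w z ∂κ y ∂resolventKernel κ x + 1) +
        ∫⁻ z, Vᶜ.indicator (fun _ => (b : ℝ≥0∞)) z ∂resolventKernel κ x := by rw [h1]; ring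
    _ ≤ w x + (∫⁻ z, w z ∂resolventKernel κ x +
        ∫⁻ z, V.indicator (fun _ => (b : ℝ≥0∞)) z ∂resolventKernel κ x) +
        ∫⁻ z, Vᶜ.indicator (fun _ => (b : ℝ≥0∞)) z ∂resolventKernel κ x := by gcongr
    _ = w x + ∫⁻ z, w z ∂resolventKernel κ x +
        (∫⁻ z, V.indicator (fun _ => (b : ℝ≥0∞)) z ∂resolventKernel κ x +
        ∫⁻ z, Vᶜ.indicator (fun _ => (b : ℝ≥0∞)) z ∂resolventKernel κ x) := by ring
    _ = _ := by rw [h3]; ring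

end Resolvent

/-! ### Splitting off the minorant -/

section Split

variable {S : Type*} [MeasurableSpace S]

/-- A kernel that dominates `c • μ` on `V` splits off that part. -/
lemma exists_kernel_split (K : Kernel S S) [IsMarkovKernel K] {V : Set S} (hV : MeasurableSet V)
    (μ : Measure S) [IsProbabilityMeasure μ] (c : ℝ≥0) (h : ∀ x ∈ V, c • μ ≤ K x) :
    ∃ T : Kernel S S, ∀ x (ξ : S → ℝ≥0∞), ∫⁻ z, ξ z ∂K x =
      ∫⁻ z, ξ z ∂T x + V.indicator (fun _ => c * ∫⁻ z, ξ z ∂μ) x := by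
  classical
  let F : S → Measure S := fun x => if x ∈ V then K x - c • μ else K x
  have hF : Measurable F := by
    refine Measure.measurable_of_measurable_coe _ fun A hA => ?_
    have : (fun x => F x A) = fun x => if x ∈ V then K x A - (c • μ) A else K x A := by
      ext x
      by_cases hx : x ∈ V
      · simp only [F, hx, if_true]
        rw [Measure.sub_apply hA (h x hx)]
      · simp [F, hx]
    rw [this]
    exact Measurable.ite hV ((K.measurable_coe hA).sub measurable_const) (K.measurable_coe hA)
  refine ⟨⟨F, hF⟩, fun x ξ => ?_⟩
  by_cases hx : x ∈ V
  · have : F x + c • μ = K x := by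
      simp only [F, hx, if_true]
      exact Measure.sub_add_cancel_of_le (h x hx)
    simp only [Kernel.coe_mk, Set.indicator_of_mem hx]
    rw [← this, lintegral_add_measure]
    congr 1
    exact lintegral_smul_measure _ _
  · simp [F, hx]

end Split

/-! ### Regeneration cycles and uniform averages -/

section Regeneration

variable {S : Type*} [MeasurableSpace S]

lemma measurable_expectedSum {κ : Kernel S S} {ψ : S → ℝ≥0∞} (hψ : Measurable ψ) (k : ℕ) :
    Measurable (expectedSum κ ψ k) :=
  Finset.measurable_fun_sum _ fun _ _ => hψ.lintegral_kernel

/-- A kernel `K` that splits off `c • μ` on `V`, together with a drift function that makes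
the visits to `V` frequent. -/
structure RegenerativeSplit (K T : Kernel S S) (μ : Measure S) (V : Set S) (c b : ℝ≥0)
    (w : S → ℝ≥0∞) : Prop where
  measurableSet : MeasurableSet V
  nonempty : V.Nonempty
  pos : 0 < c
  split : ∀ x (ξ : S → ℝ≥0∞), ∫⁻ z, ξ z ∂K x =
    ∫⁻ z, ξ z ∂T x + V.indicator (fun _ => c * ∫⁻ z, ξ z ∂μ) x
  measurable_drift : Measurable w
  drift : ∀ x, ∫⁻ z, w z ∂K x + 1 ≤ w x + V.indicator (fun _ => (b : ℝ≥0∞)) x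
  drift_eq_zero : ∀ x ∈ V, w x = 0

namespace RegenerativeSplit

variable {K T : Kernel S S} {μ : Measure S}
  {V : Set S} {c b : ℝ≥0} {w : S → ℝ≥0∞}

/-- The Poisson equation for `K`: the potential of `ψ` compensates `ψ` up to a multiple of `1_V`. -/
lemma lintegral_kernel_green (h : RegenerativeSplit K T μ V c b w) {ψ : S → ℝ≥0∞}
    (hψ : Measurable ψ) (x : S) :
    ∫⁻ y, ∫⁻ z, ψ z ∂greenKernel T y ∂K x + ψ x = ∫⁻ z, ψ z ∂greenKernel T x +
      V.indicator (fun _ => c * ∫⁻ y, ∫⁻ z, ψ z ∂greenKernel T y ∂μ) x := by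
  rw [h.split, lintegral_greenKernel_eq T hψ x]
  ring

lemma green_one_le [IsMarkovKernel K] [IsProbabilityMeasure μ]
    (h : RegenerativeSplit K T μ V c b w) (x : S) :
    ∫⁻ _, 1 ∂greenKernel T x ≤ w x + (b / c : ℝ≥0) := by
  have hc : c * (b / c) = b := mul_div_cancel₀ _ h.pos.ne'
  refine lintegral_greenKernel_le T (W := fun x => w x + (b / c : ℝ≥0)) measurable_const
    (h.measurable_drift.add_const _) (fun x => ?_) x
  have h1 : ∫⁻ z, (w z + (b / c : ℝ≥0)) ∂K x + 1 ≤
      w x + (b / c : ℝ≥0) + V.indicator (fun _ => (b : ℝ≥0∞)) x := by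
    rw [lintegral_add_right _ measurable_const]
    simp only [lintegral_const, measure_univ, mul_one]
    calc _ = ∫⁻ z, w z ∂K x + 1 + (b / c : ℝ≥0) := by ring
      _ ≤ w x + V.indicator (fun _ => (b : ℝ≥0∞)) x + (b / c : ℝ≥0) := by
        exact add_le_add_left (h.drift x) _
      _ = _ := by ring
  rw [h.split] at h1
  by_cases hx : x ∈ V
  · simp only [Set.indicator_of_mem hx] at h1
    refine (ENNReal.add_le_add_iff_right (a := (b : ℝ≥0∞)) ENNReal.coe_ne_top).1 (le_trans ?_ h1)
    -- The shift `b / c` is chosen so that the mass `c` removed on `V` carries at least `b`,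
    -- cancelling the drift excess.
    have : (b : ℝ≥0∞) ≤ c * ∫⁻ z, (w z + (b / c : ℝ≥0)) ∂μ := by
      calc (b : ℝ≥0∞) = c * ∫⁻ _, ((b / c : ℝ≥0) : ℝ≥0∞) ∂μ := by
            simp only [lintegral_const, measure_univ, mul_one]
            rw [← ENNReal.coe_mul, hc]
        _ ≤ _ := by gcongr; exact le_add_self
    calc _ = ∫⁻ z, (w z + (b / c : ℝ≥0)) ∂T x + b + 1 := by ring
      _ ≤ _ := by gcongr
  · simpa [Set.indicator_of_notMem hx] using h1

/-- The occupation measure of a cycle. -/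
noncomputable def cycle (T : Kernel S S) (μ : Measure S) : Measure S := μ.bind (greenKernel T)

lemma lintegral_cycle (T : Kernel S S) (μ : Measure S) {ψ : S → ℝ≥0∞} (hψ : Measurable ψ) :
    ∫⁻ z, ψ z ∂cycle T μ = ∫⁻ y, ∫⁻ z, ψ z ∂greenKernel T y ∂μ :=
  Measure.lintegral_bind (greenKernel T).aemeasurable hψ.aemeasurable

lemma lintegral_cycle_eq {ψ : S → ℝ≥0∞} (hψ : Measurable ψ) :
    ∫⁻ z, ψ z ∂cycle T μ = ∫⁻ z, ψ z ∂μ + ∫⁻ y, ∫⁻ z, ψ z ∂T y ∂cycle T μ := by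
  rw [lintegral_cycle T μ hψ, lintegral_cycle T μ hψ.lintegral_kernel]
  simp_rw [lintegral_greenKernel_eq' T hψ]
  rw [lintegral_add_left hψ]

/-- From a point of `V`, the chain regenerates with mass `c`, so `c` times the cycle length is at
most the `K`-mean of the potential of 1, which the drift bounds. -/
lemma cycle_univ_ne_top [IsMarkovKernel K] [IsProbabilityMeasure μ]
    (h : RegenerativeSplit K T μ V c b w) : cycle T μ Set.univ ≠ ∞ := by
  obtain ⟨x, hx⟩ := h.nonempty
  have hc : (c : ℝ≥0∞) ≠ 0 := by simpa using h.pos.ne'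
  rw [← lintegral_one, lintegral_cycle T μ measurable_const]
  have h1 := h.split x fun y => ∫⁻ _, 1 ∂greenKernel T y
  rw [Set.indicator_of_mem hx] at h1
  intro hinf
  rw [hinf, ENNReal.mul_top hc, add_top] at h1
  have h2 : ∫⁻ y, ∫⁻ _, 1 ∂greenKernel T y ∂K x ≤ b + (b / c : ℝ≥0) :=
    calc _ ≤ ∫⁻ y, (w y + (b / c : ℝ≥0)) ∂K x := lintegral_mono h.green_one_le
      _ = ∫⁻ y, w y ∂K x + (b / c : ℝ≥0) := by
        rw [lintegral_add_right _ measurable_const]; simp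
      _ ≤ _ := by
        gcongr
        have := h.drift x
        rw [h.drift_eq_zero x hx, Set.indicator_of_mem hx, zero_add] at this
        exact le_self_add.trans this
  rw [h1] at h2
  exact absurd h2 (by simp [← ENNReal.coe_add])

lemma one_le_cycle_univ [IsProbabilityMeasure μ] : 1 ≤ cycle T μ Set.univ := by
  rw [← lintegral_one, lintegral_cycle_eq measurable_const]
  simp

/-- Mass balance: a cycle starts once with law `μ` and ends once, through `V`. -/
lemma mul_cycle_eq_one [IsMarkovKernel K] [IsProbabilityMeasure μ]
    (h : RegenerativeSplit K T μ V c b w) : c * cycle T μ V = 1 := by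
  have h1 := lintegral_cycle_eq (T := T) (μ := μ) (measurable_const (a := (1 : ℝ≥0∞)))
  have h2 : ∫⁻ _, 1 ∂cycle T μ = ∫⁻ y, ∫⁻ _, 1 ∂T y ∂cycle T μ + c * cycle T μ V := by
    calc ∫⁻ _, 1 ∂cycle T μ = ∫⁻ y, ∫⁻ _, 1 ∂K y ∂cycle T μ := by simp
      _ = ∫⁻ y, (∫⁻ _, 1 ∂T y + V.indicator (fun _ => (c : ℝ≥0∞)) y) ∂cycle T μ := by
        simp_rw [h.split _ fun _ => 1]; simp
      _ = _ := by
        rw [lintegral_add_left (measurable_const (a := (1 : ℝ≥0∞))).lintegral_kernel,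
          lintegral_indicator_const h.measurableSet]
  have hfin : ∫⁻ y, ∫⁻ _, 1 ∂T y ∂cycle T μ ≠ ∞ := by
    refine ne_top_of_le_ne_top h.cycle_univ_ne_top ?_
    rw [← lintegral_one, h2]
    exact le_self_add
  rw [h2, add_comm] at h1
  simpa using (ENNReal.add_left_inj hfin).1 h1

lemma lintegral_cycle_kernel [IsMarkovKernel K] [IsProbabilityMeasure μ]
    (h : RegenerativeSplit K T μ V c b w) {ψ : S → ℝ≥0∞}
    (hψ : Measurable ψ) : ∫⁻ y, ∫⁻ z, ψ z ∂K y ∂cycle T μ = ∫⁻ z, ψ z ∂cycle T μ := by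
  rw [lintegral_cycle_eq hψ, lintegral_congr fun y => h.split y ψ,
    lintegral_add_left hψ.lintegral_kernel, lintegral_indicator_const h.measurableSet, add_comm]
  congr 1
  rw [mul_right_comm, h.mul_cycle_eq_one, one_mul]

lemma expectedSum_one_succ (k : ℕ) (x : S) :
    expectedSum T (fun _ => 1) (k + 1) x =
      1 + ∫⁻ y, expectedSum T (fun _ => 1) k y ∂T x := by
  unfold expectedSum
  rw [Finset.sum_range_succ', add_comm, lintegral_kernel_pow_zero T measurable_const,
    lintegral_finsetSum _ fun j _ => measurable_const.lintegral_kernel]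
  simp_rw [lintegral_kernel_pow_succ' T _ measurable_const]

lemma expectedSum_one_le [IsMarkovKernel K] (h : RegenerativeSplit K T μ V c b w) (k : ℕ) (x : S) :
    expectedSum T (fun _ => 1) k x ≤ k := by
  have h1 : ∀ (k : ℕ) x, ∫⁻ _, 1 ∂(T ^ k) x ≤ 1 := by
    intro k
    induction k with
    | zero => intro x; rw [lintegral_kernel_pow_zero T measurable_const]
    | succ k ih =>
      intro x
      rw [lintegral_kernel_pow_succ' T _ measurable_const]
      calc _ ≤ ∫⁻ _, 1 ∂T x := lintegral_mono ih
        _ ≤ ∫⁻ _, 1 ∂K x := by rw [h.split]; exact le_self_add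
        _ = 1 := by simp
  calc _ ≤ ∑ _t ∈ Finset.range k, (1 : ℝ≥0∞) := Finset.sum_le_sum fun t _ => h1 t x
    _ = k := by simp

lemma iSup_lintegral_expectedSum_one :
    ⨆ k, ∫⁻ x, expectedSum T (fun _ => 1) k x ∂μ = cycle T μ Set.univ := by
  rw [← lintegral_one, lintegral_cycle T μ measurable_const, ← lintegral_iSup]
  · refine lintegral_congr fun x => ?_
    rw [lintegral_greenKernel, ENNReal.tsum_eq_iSup_nat]
    rfl
  · exact fun k => measurable_expectedSum measurable_const k
  · exact fun i j hij x => Finset.sum_le_sum_of_subset (Finset.range_mono hij)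

variable {κ : Kernel S S} [IsMarkovKernel κ]

/-- Resolvent invariance and `two_mul_lintegral_resolventKernel` give `2ν = ν + νκ`; finiteness of
`ν` permits cancelling. -/
lemma invariant_cycle [IsProbabilityMeasure μ]
    (h : RegenerativeSplit (resolventKernel κ) T μ V c b w) :
    Kernel.Invariant κ (cycle T μ) := by
  ext A hA
  have hm : Measurable (A.indicator (1 : S → ℝ≥0∞)) := measurable_one.indicator hA
  have hf : cycle T μ A ≠ ∞ := ne_top_of_le_ne_top h.cycle_univ_ne_top
    (measure_mono (Set.subset_univ A))
  have h1 := h.lintegral_cycle_kernel hm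
  have h2 := h.lintegral_cycle_kernel hm.lintegral_kernel (ψ := fun y => ∫⁻ z, A.indicator 1 z ∂κ y)
  have h3 : ∫⁻ y, 2 * ∫⁻ z, A.indicator 1 z ∂resolventKernel κ y ∂cycle T μ =
      cycle T μ A + ∫⁻ y, ∫⁻ z, A.indicator 1 z ∂κ y ∂cycle T μ := by
    simp_rw [two_mul_lintegral_resolventKernel κ hm]
    rw [lintegral_add_left hm, lintegral_indicator_one hA, h2]
  rw [lintegral_const_mul _ hm.lintegral_kernel, h1, two_mul, lintegral_indicator_one hA] at h3
  have h4 := (ENNReal.add_right_inj hf).1 h3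
  rw [Measure.bind_apply hA κ.aemeasurable, h4]
  simp_rw [lintegral_indicator_one hA]

/-- Applying the resolvent to the potential `q` gives `r`, which solves the Poisson equation for `κ`
itself; iterating it leaves only the initial value of `r`, bounded on `V`. -/
lemma expectedSum_le [IsProbabilityMeasure μ]
    (h : RegenerativeSplit (resolventKernel κ) T μ V c b w)
    {ψ : S → ℝ≥0∞} (hψ : Measurable ψ) {M : ℝ≥0} (hM : ∀ x, ψ x ≤ M) (n : ℕ) {x : S}
    (hx : x ∈ V) :
    expectedSum κ ψ n x ≤ M * (b + (b / c : ℝ≥0)) + c * (∫⁻ z, ψ z ∂cycle T μ) *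
      expectedSum κ (V.indicator fun _ => 1) n x := by
  set q : S → ℝ≥0∞ := fun y => ∫⁻ z, ψ z ∂greenKernel T y with hq
  have hqm : Measurable q := hψ.lintegral_kernel
  set r : S → ℝ≥0∞ := fun y => ∫⁻ z, q z ∂resolventKernel κ y with hr
  have hrm : Measurable r := hqm.lintegral_kernel
  have hind : ∀ a : ℝ≥0∞, ∀ y, V.indicator (fun _ => a) y = a * V.indicator (fun _ => 1) y := by
    intro a y
    by_cases hy : y ∈ V <;> simp [hy]
  have step : ∀ y, ∫⁻ z, r z ∂κ y + ψ y ≤ r y +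
      c * (∫⁻ z, ψ z ∂cycle T μ) * V.indicator (fun _ => 1) y := by
    intro y
    by_cases hy : r y = ∞
    · simp [hy]
    have h2 : 2 * r y = q y + ∫⁻ z, r z ∂κ y := by
      rw [hr, lintegral_lintegral_resolventKernel_comm κ hqm]
      exact two_mul_lintegral_resolventKernel κ hqm y
    have hqy : q y ≠ ∞ :=
      ne_top_of_le_ne_top (ENNReal.mul_ne_top ENNReal.ofNat_ne_top hy) (h2 ▸ le_self_add)
    have h3 := h.lintegral_kernel_green hψ y
    rw [hind, ← lintegral_cycle T μ hψ] at h3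
    refine (ENNReal.add_le_add_iff_left hqy).1 (le_of_eq ?_)
    calc q y + (∫⁻ z, r z ∂κ y + ψ y) = r y + (r y + ψ y) := by
          rw [← add_assoc, ← h2]; ring
      _ = r y + (q y + c * (∫⁻ z, ψ z ∂cycle T μ) * V.indicator (fun _ => 1) y) := by
          rw [← h3]
      _ = _ := by ring
  have hqle : ∀ y, q y ≤ M * (w y + (b / c : ℝ≥0)) := by
    intro y
    calc q y ≤ ∫⁻ _, M * 1 ∂greenKernel T y := by
          refine lintegral_mono fun z => ?_
          rw [mul_one]
          exact hM z
      _ = M * ∫⁻ _, 1 ∂greenKernel T y := lintegral_const_mul _ measurable_const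
      _ ≤ _ := by gcongr; exact h.green_one_le y
  have hrx : r x ≤ M * (b + (b / c : ℝ≥0)) := by
    calc r x ≤ ∫⁻ y, M * (w y + (b / c : ℝ≥0)) ∂resolventKernel κ x := lintegral_mono hqle
      _ = M * (∫⁻ y, w y ∂resolventKernel κ x + (b / c : ℝ≥0)) := by
          rw [lintegral_const_mul _ (h.measurable_drift.add_const _),
            lintegral_add_right _ measurable_const]
          simp
      _ ≤ _ := by
          gcongr
          have := h.drift x
          rw [h.drift_eq_zero x hx, Set.indicator_of_mem hx, zero_add] at this
          exact le_self_add.trans this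
  have := iterate_drift_le hrm hψ step n x
  rw [expectedSum_const_mul (measurable_const.indicator h.measurableSet)] at this
  exact le_add_self.trans (this.trans (add_le_add_left hrx _))

/-- The reverse comparison, for `ψ = 1`, must discard a terminal value of `r`. Truncating the
potential to `k` terms bounds that value by `k`. -/
lemma mul_expectedSum_indicator_le (h : RegenerativeSplit (resolventKernel κ) T μ V c b w)
    (k n : ℕ) (x : S) :
    c * (∫⁻ y, expectedSum T (fun _ => 1) k y ∂μ) *
      expectedSum κ (V.indicator fun _ => 1) n x ≤ n + k := by
  set q : S → ℝ≥0∞ := expectedSum T (fun _ => 1) k with hq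
  have hqm : Measurable q := measurable_expectedSum measurable_const k
  set r : S → ℝ≥0∞ := fun y => ∫⁻ z, q z ∂resolventKernel κ y with hr
  have hrm : Measurable r := hqm.lintegral_kernel
  have hqk : ∀ y, q y ≤ k := h.expectedSum_one_le k
  have hrk : ∀ y, r y ≤ k := fun y =>
    (lintegral_mono hqk).trans (by simp)
  have step : ∀ y, r y + c * (∫⁻ y, q y ∂μ) * V.indicator (fun _ => 1) y ≤
      ∫⁻ z, r z ∂κ y + 1 := by
    intro y
    have h2 : 2 * r y = q y + ∫⁻ z, r z ∂κ y := by
      rw [hr, lintegral_lintegral_resolventKernel_comm κ hqm]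
      exact two_mul_lintegral_resolventKernel κ hqm y
    have hqy : q y ≠ ∞ := ne_top_of_le_ne_top (ENNReal.natCast_ne_top k) (hqk y)
    have h3 : r y + 1 = expectedSum T (fun _ => 1) (k + 1) y +
        c * (∫⁻ y, q y ∂μ) * V.indicator (fun _ => 1) y := by
      rw [expectedSum_one_succ, hr]
      simp only
      rw [h.split]
      by_cases hy : y ∈ V
      · simp only [Set.indicator_of_mem hy]; ring
      · simp only [Set.indicator_of_notMem hy]; ring
    have h4 : q y ≤ expectedSum T (fun _ => 1) (k + 1) y :=
      Finset.sum_le_sum_of_subset (Finset.range_mono k.le_succ)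
    refine (ENNReal.add_le_add_iff_left hqy).1 ?_
    calc q y + (r y + c * (∫⁻ y, q y ∂μ) * V.indicator (fun _ => 1) y)
        ≤ expectedSum T (fun _ => 1) (k + 1) y +
          (r y + c * (∫⁻ y, q y ∂μ) * V.indicator (fun _ => 1) y) := by gcongr
      _ = r y + (r y + 1) := by rw [h3]; ring
      _ = 2 * r y + 1 := by ring
      _ = _ := by rw [h2]; ring
  have := le_iterate_drift hrm measurable_const step n x
  rw [expectedSum_const_mul (measurable_const.indicator h.measurableSet), expectedSum_const,
    mul_one] at this
  calc _ ≤ _ := le_add_self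
    _ ≤ _ := this
    _ ≤ k + n := by
      gcongr
      exact (lintegral_mono hrk).trans (by simp)
    _ = _ := add_comm _ _

end RegenerativeSplit

/-- A chain with a small set whose return times have bounded means has an invariant probability
measure `π`, and the expected time averages of a bounded function are eventually at most its
`π`-mean, uniformly over the initial states in the small set. -/
theorem exists_invariant_uniform_average_le (κ : Kernel S S) [IsMarkovKernel κ] {V : Set S}
    (hV : MeasurableSet V) (hne : V.Nonempty) {w : S → ℝ≥0∞} (hw : Measurable w) {b : ℝ≥0}
    (hdrift : ∀ x, ∫⁻ z, w z ∂κ x + 1 ≤ w x + V.indicator (fun _ => (b : ℝ≥0∞)) x)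
    (hw0 : ∀ x ∈ V, w x = 0) (hmin : HasMinorant κ V) :
    ∃ π : Measure S, IsProbabilityMeasure π ∧ Kernel.Invariant κ π ∧
      ∀ (ψ : S → ℝ≥0∞) (M η : ℝ≥0), Measurable ψ → (∀ x, ψ x ≤ M) → 0 < η →
        ∃ n₀ : ℕ, ∀ n ≥ n₀, ∀ x ∈ V, expectedSum κ ψ n x ≤ n * (∫⁻ z, ψ z ∂π + η) := by
  obtain ⟨p, μ, m, hp, -, hμ, -, hle⟩ := hmin
  set c : ℝ≥0 := 2⁻¹ ^ (m + 1) * p with hc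
  have hle' : ∀ x ∈ V, c • μ ≤ resolventKernel κ x := by
    intro x hx
    refine le_trans ?_ (smul_pow_le_resolventKernel κ m x)
    rw [hc, mul_smul]
    refine Measure.le_iff.2 fun A _ => ?_
    have := hle x hx A
    simp only [Measure.smul_apply, ENNReal.smul_def, smul_eq_mul] at this ⊢
    push_cast
    exact mul_le_mul_right this _
  obtain ⟨T, hT⟩ := exists_kernel_split (resolventKernel κ) hV μ c hle'
  have h : RegenerativeSplit (resolventKernel κ) T μ V c b
      (fun x => w x + Vᶜ.indicator (fun _ => (b : ℝ≥0∞)) x) :=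
    { measurableSet := hV
      nonempty := hne
      pos := by positivity
      split := hT
      measurable_drift := hw.add (measurable_const.indicator hV.compl)
      drift := fun x => by
        refine (lintegral_resolventKernel_drift κ hV hw hdrift x).trans (le_of_eq ?_)
        by_cases hx : x ∈ V <;> simp [hx]
      drift_eq_zero := fun x hx => by simp [hw0 x hx, hx] }
  set ν := RegenerativeSplit.cycle T μ with hν
  have hν1 : ν Set.univ ≠ ∞ := h.cycle_univ_ne_top
  have hν0 : ν Set.univ ≠ 0 := (zero_lt_one.trans_le RegenerativeSplit.one_le_cycle_univ).ne'
  refine ⟨(ν Set.univ)⁻¹ • ν, ⟨?_⟩, ?_, ?_⟩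
  · rw [Measure.smul_apply, smul_eq_mul, ENNReal.inv_mul_cancel hν0 hν1]
  · have := h.invariant_cycle
    rw [Kernel.Invariant, Measure.comp_smul, this]
  · intro ψ M η hψ hM hη
    rw [lintegral_smul_measure, smul_eq_mul]
    set I := ∫⁻ z, ψ z ∂ν with hI
    have hIfin : I ≠ ∞ := by
      refine ne_top_of_le_ne_top (ENNReal.mul_ne_top (ENNReal.coe_ne_top (r := M)) hν1) ?_
      rw [← lintegral_const]
      exact lintegral_mono hM
    set ρ : ℝ≥0∞ := (ν Set.univ)⁻¹ * I + (η / 2 : ℝ≥0) with hρ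
    have hη2 : ((η / 2 : ℝ≥0) : ℝ≥0∞) ≠ 0 := by
      rw [ENNReal.coe_ne_zero]
      positivity
    have hρfin : ρ ≠ ∞ := ENNReal.add_ne_top.2
      ⟨ENNReal.mul_ne_top (ENNReal.inv_ne_top.2 hν0) hIfin, ENNReal.coe_ne_top⟩
    -- The slack `η / 2` in `ρ` lets a truncated cycle length, times `ρ`, already exceed `I`; the
    -- other `η / 2` absorbs the terms independent of `n`.
    have hlt : I < ⨆ k : ℕ, (∫⁻ y, expectedSum T (fun _ => 1) k y ∂μ) * ρ := by
      rw [← ENNReal.iSup_mul, RegenerativeSplit.iSup_lintegral_expectedSum_one, hρ, mul_add,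
        ← mul_assoc, ENNReal.mul_inv_cancel hν0 hν1, one_mul]
      exact ENNReal.lt_add_right hIfin (mul_ne_zero hν0 hη2)
    obtain ⟨k, hk⟩ := lt_iSup_iff.1 hlt
    have hCfin : (M * (b + (b / c : ℝ≥0)) + k * ρ : ℝ≥0∞) ≠ ∞ := by
      refine ENNReal.add_ne_top.2 ⟨?_, ENNReal.mul_ne_top (ENNReal.natCast_ne_top k) hρfin⟩
      rw [← ENNReal.coe_add, ← ENNReal.coe_mul]
      exact ENNReal.coe_ne_top
    obtain ⟨n₀, hn₀⟩ := ENNReal.exists_nat_mul_gt hη2 hCfin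
    refine ⟨n₀, fun n hn x hx => ?_⟩
    calc expectedSum κ ψ n x
        ≤ M * (b + (b / c : ℝ≥0)) + c * I * expectedSum κ (V.indicator fun _ => 1) n x :=
          h.expectedSum_le hψ hM n hx
      _ ≤ M * (b + (b / c : ℝ≥0)) + c * ((∫⁻ y, expectedSum T (fun _ => 1) k y ∂μ) * ρ) *
          expectedSum κ (V.indicator fun _ => 1) n x := by gcongr
      _ = M * (b + (b / c : ℝ≥0)) + c * (∫⁻ y, expectedSum T (fun _ => 1) k y ∂μ) *
          expectedSum κ (V.indicator fun _ => 1) n x * ρ := by ring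
      _ ≤ M * (b + (b / c : ℝ≥0)) + (n + k) * ρ := by
          gcongr
          exact h.mul_expectedSum_indicator_le k n x
      _ = M * (b + (b / c : ℝ≥0)) + k * ρ + n * ρ := by ring
      _ ≤ n * (η / 2 : ℝ≥0) + n * ρ := by
          gcongr
          exact hn₀.le.trans (by gcongr)
      _ = n * ((ν Set.univ)⁻¹ * I + ((η / 2 : ℝ≥0) + (η / 2 : ℝ≥0))) := by rw [hρ]; ring
      _ = _ := by rw [← ENNReal.coe_add, add_halves]

end Regeneration

/-! ### Kac's inequality -/

section Kac

variable {S : Type*} [MeasurableSpace S] {κ : Kernel S S} {V : Set S}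

lemma lintegral_indicator_compl_meanReturn (hV : MeasurableSet V) (x : S) :
    ∫⁻ z, Vᶜ.indicator (meanReturn κ V) z ∂κ x + 1 =
      Vᶜ.indicator (meanReturn κ V) x + V.indicator (meanReturn κ V) x := by
  rw [lintegral_indicator hV.compl, add_comm, ← meanReturn_eq hV x]
  by_cases hx : x ∈ V <;> simp [hx]

/-- The easy half of Kac's formula. -/
lemma lintegral_indicator_meanReturn_le_one [IsMarkovKernel κ] (hV : MeasurableSet V)
    (π : Measure S)
    [IsProbabilityMeasure π] (hπ : Kernel.Invariant κ π) :
    ∫⁻ x, V.indicator (meanReturn κ V) x ∂π ≤ 1 := by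
  set H : ℕ → S → ℝ≥0∞ := fun k x => ∑ j ∈ Finset.range k, survival κ V j x with hH
  have hm : ∀ k, Measurable (H k) := fun k =>
    Finset.measurable_fun_sum _ fun j _ => measurable_survival hV j
  have hmono : ∀ k x, H k x ≤ H (k + 1) x := fun k x =>
    Finset.sum_le_sum_of_subset (Finset.range_mono k.le_succ)
  have hHk : ∀ k x, H k x ≤ k := fun k x =>
    (Finset.sum_le_sum fun j _ => survival_le_one j x).trans (by simp)
  -- By invariance `π(H (k+1)) = 1 + π(1_{Vᶜ} H k)`, while `H k ≤ H (k+1)`. Truncation makes the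
  -- common term finite.
  have key : ∀ k, ∫⁻ x, V.indicator (H k) x ∂π ≤ 1 := by
    intro k
    have hfin : ∫⁻ x, Vᶜ.indicator (H k) x ∂π ≠ ∞ := by
      refine ne_top_of_le_ne_top (ENNReal.natCast_ne_top k) ?_
      calc _ ≤ ∫⁻ _, (k : ℝ≥0∞) ∂π :=
            lintegral_mono fun x => (Set.indicator_le_self _ _ x).trans (hHk k x)
        _ = k := by simp
    have h1 : ∫⁻ x, H (k + 1) x ∂π = 1 + ∫⁻ x, Vᶜ.indicator (H k) x ∂π := by
      simp_rw [hH, sum_survival_succ hV]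
      rw [lintegral_add_left measurable_const]
      congr 1
      · simp
      · conv_rhs => rw [← hπ.def]
        rw [Measure.lintegral_bind κ.aemeasurable ((hm k).indicator hV.compl).aemeasurable]
        simp_rw [lintegral_indicator hV.compl]
        rfl
    refine (ENNReal.add_le_add_iff_right hfin).1 ?_
    rw [← h1, lintegral_indicator hV, lintegral_indicator hV.compl, lintegral_add_compl _ hV]
    exact lintegral_mono (hmono k)
  have hsup : ∀ x, V.indicator (meanReturn κ V) x = ⨆ k, V.indicator (H k) x := by
    intro x
    by_cases hx : x ∈ V
    · simp only [Set.indicator_of_mem hx, hH]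
      exact ENNReal.tsum_eq_iSup_nat
    · simp [hx]
  simp_rw [hsup]
  rw [lintegral_iSup fun k => (hm k).indicator hV]
  · exact iSup_le key
  · exact monotone_nat_of_le_succ fun k x => Set.indicator_le_indicator (hmono k x)

lemma survival_empty [IsMarkovKernel κ] (k : ℕ) (x : S) : survival κ ∅ k x = 1 := by
  induction k generalizing x with
  | zero => rfl
  | succ k ih => simp [survival, ih]

end Kac

/-! ### The autonomous component and the drift of `L₂` -/

section Autonomous

variable {𝓧 𝓨 : Type*} [MeasurableSpace 𝓧] [MeasurableSpace 𝓨]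
  {κ : Kernel (𝓧 × 𝓨) (𝓧 × 𝓨)} {κX : Kernel 𝓧 𝓧}

lemma lintegral_fst_of_autonomous (hA0 : ∀ x y, (κ (x, y)).map Prod.fst = κX x)
    {g : 𝓧 → ℝ≥0∞} (hg : Measurable g) (z : 𝓧 × 𝓨) :
    ∫⁻ z', g z'.1 ∂κ z = ∫⁻ x, g x ∂κX z.1 := by
  rw [← hA0 z.1 z.2, lintegral_map hg measurable_fst]

lemma lintegral_pow_fst_of_autonomous (hA0 : ∀ x y, (κ (x, y)).map Prod.fst = κX x)
    (t : ℕ) {g : 𝓧 → ℝ≥0∞} (hg : Measurable g) (z : 𝓧 × 𝓨) :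
    ∫⁻ z', g z'.1 ∂(κ ^ t) z = ∫⁻ x, g x ∂(κX ^ t) z.1 := by
  have hg' : Measurable fun z : 𝓧 × 𝓨 => g z.1 := hg.comp measurable_fst
  induction t generalizing z with
  | zero =>
    rw [lintegral_kernel_pow_zero κ hg', lintegral_kernel_pow_zero κX hg]
  | succ t ih =>
    rw [lintegral_kernel_pow_succ' κ t hg',
      lintegral_kernel_pow_succ' κX t hg]
    simp_rw [ih]
    exact lintegral_fst_of_autonomous hA0 hg.lintegral_kernel z

lemma expectedSum_fst_of_autonomous (hA0 : ∀ x y, (κ (x, y)).map Prod.fst = κX x)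
    (n : ℕ) {g : 𝓧 → ℝ≥0∞} (hg : Measurable g) (z : 𝓧 × 𝓨) :
    expectedSum κ (fun z' => g z'.1) n z = expectedSum κX g n z.1 :=
  Finset.sum_congr rfl fun t _ => lintegral_pow_fst_of_autonomous hA0 t hg z

/-- If the autonomous component returns to `V` almost surely, and the chain returns to
`D ⊆ V × 𝓨` almost surely from `V × 𝓨`, then it returns to `D` from everywhere. -/
lemma iInf_survival_eq_zero_of_autonomous [IsMarkovKernel κ]
    (hA0 : ∀ x y, (κ (x, y)).map Prod.fst = κX x) {V : Set 𝓧} (hV : MeasurableSet V)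
    (hVτ : ∀ x, ⨅ k, survival κX V k x = 0) {D : Set (𝓧 × 𝓨)} (hD : MeasurableSet D)
    (h : ∀ z : 𝓧 × 𝓨, z.1 ∈ V → ⨅ k, survival κ D k z = 0) (z : 𝓧 × 𝓨) :
    ⨅ k, survival κ D k z = 0 := by
  -- A path that never meets `D` cannot, up to null events, have its first component in `V` at times
  -- `1, …, k`.
  have key : ∀ k (z : 𝓧 × 𝓨), ⨅ j, survival κ D j z ≤ survival κX V k z.1 := by
    intro k
    induction k with
    | zero => exact fun z => iInf_le (fun j => survival κ D j z) 0
    | succ k ih =>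
      intro z
      refine (iInf_survival_le_setLIntegral hD z).trans
        ((setLIntegral_le_lintegral _ _).trans ?_)
      change _ ≤ ∫⁻ x in Vᶜ, survival κX V k x ∂κX z.1
      rw [← lintegral_indicator hV.compl,
        ← lintegral_fst_of_autonomous hA0 ((measurable_survival hV k).indicator hV.compl) z]
      refine lintegral_mono fun z' => ?_
      by_cases hz : z'.1 ∈ V
      · simp only [h z' hz, zero_le]
      · simpa [hz] using ih z'
  exact le_antisymm ((le_iInf fun k => key k z).trans (hVτ z.1).le) zero_le

variable {L₂ : 𝓨 → ℝ} {U : ℝ≥0}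

/-- Used with `a = 0` for the growth of `L₂` and with `a = L₂ z.2` for its displacement. -/
lemma lintegral_abs_sub_le (hL₂ : Measurable L₂)
    (hB1 : ∀ x y, ∫⁻ z, ENNReal.ofReal |L₂ z.2 - L₂ y| ∂(κ (x, y)) ≤ U) [IsMarkovKernel κ]
    (t : ℕ) (z : 𝓧 × 𝓨) (a : ℝ) :
    ∫⁻ z', ENNReal.ofReal |L₂ z'.2 - a| ∂(κ ^ t) z ≤ ENNReal.ofReal |L₂ z.2 - a| + t * U := by
  have hm : Measurable fun z' : 𝓧 × 𝓨 => ENNReal.ofReal |L₂ z'.2 - a| :=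
    (((hL₂.comp measurable_snd).sub_const a).abs).ennreal_ofReal
  have step : ∀ z : 𝓧 × 𝓨, ∫⁻ z', ENNReal.ofReal |L₂ z'.2 - a| ∂κ z + 0 ≤
      ENNReal.ofReal |L₂ z.2 - a| + U := by
    intro z
    have hm' : Measurable fun z' : 𝓧 × 𝓨 => ENNReal.ofReal |L₂ z'.2 - L₂ z.2| :=
      (((hL₂.comp measurable_snd).sub_const _).abs).ennreal_ofReal
    calc _ ≤ ∫⁻ z', (ENNReal.ofReal |L₂ z'.2 - L₂ z.2| + ENNReal.ofReal |L₂ z.2 - a|) ∂κ z := by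
          rw [add_zero]
          refine lintegral_mono fun z' => ?_
          rw [← ENNReal.ofReal_add (abs_nonneg _) (abs_nonneg _)]
          exact ENNReal.ofReal_le_ofReal (abs_sub_le _ _ _)
      _ = ∫⁻ z', ENNReal.ofReal |L₂ z'.2 - L₂ z.2| ∂κ z + ENNReal.ofReal |L₂ z.2 - a| := by
          rw [lintegral_add_left hm']; simp
      _ ≤ U + ENNReal.ofReal |L₂ z.2 - a| := add_le_add_left (hB1 z.1 z.2) _
      _ = _ := add_comm _ _
  have := iterate_drift_le (ξ := fun _ => (U : ℝ≥0∞)) hm measurable_const step t z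
  rw [expectedSum_const, expectedSum_const] at this
  simpa using this

/-- Markov's inequality: falling below `N` requires a displacement of at least `R`, whose mean
before time `n` is at most `n * U`. -/
lemma expectedSum_lt_le (hL₂ : Measurable L₂)
    (hB1 : ∀ x y, ∫⁻ z, ENNReal.ofReal |L₂ z.2 - L₂ y| ∂(κ (x, y)) ≤ U) [IsMarkovKernel κ]
    (n : ℕ) {N R : ℝ} (z : 𝓧 × 𝓨) (hz : N + R ≤ L₂ z.2) :
    ENNReal.ofReal R * expectedSum κ ({z : 𝓧 × 𝓨 | L₂ z.2 < N}.indicator fun _ => 1) n z ≤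
      n * (n * U) := by
  have hE : MeasurableSet {z : 𝓧 × 𝓨 | L₂ z.2 < N} :=
    measurableSet_lt (hL₂.comp measurable_snd) measurable_const
  rw [expectedSum, Finset.mul_sum]
  calc _ ≤ ∑ t ∈ Finset.range n, (n * U : ℝ≥0∞) := Finset.sum_le_sum fun t ht => ?_
    _ = n * (n * U) := by simp
  rw [← lintegral_const_mul _ (measurable_const.indicator hE)]
  calc _ ≤ ∫⁻ z', ENNReal.ofReal |L₂ z'.2 - L₂ z.2| ∂(κ ^ t) z := by
        refine lintegral_mono fun z' => ?_
        by_cases hz' : L₂ z'.2 < N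
        · rw [Set.indicator_of_mem (show z' ∈ {z : 𝓧 × 𝓨 | L₂ z.2 < N} from hz'), mul_one]
          refine ENNReal.ofReal_le_ofReal ?_
          rw [abs_sub_comm]
          exact le_trans (by linarith) (le_abs_self _)
        · rw [Set.indicator_of_notMem (show z' ∉ {z : 𝓧 × 𝓨 | L₂ z.2 < N} from hz'), mul_zero]
          exact zero_le
    _ ≤ ENNReal.ofReal |L₂ z.2 - L₂ z.2| + t * U := lintegral_abs_sub_le hL₂ hB1 t z _
    _ = t * U := by simp
    _ ≤ n * U := by
        have := (Finset.mem_range.1 ht).le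
        gcongr

/-- The one-step drift of `L₂` with the positive part of the drift bound truncated at `U`. -/
lemma lintegral_drift_le [IsMarkovKernel κ] (hL₂ : Measurable L₂) (hL₂_nonneg : ∀ y, 0 ≤ L₂ y)
    (hB1 : ∀ x y, ∫⁻ z, ENNReal.ofReal |L₂ z.2 - L₂ y| ∂(κ (x, y)) ≤ U)
    {h : ℝ → ℝ} (h_nonneg : ∀ N, 0 ≤ N → 0 ≤ h N) (h_anti : AntitoneOn h (Set.Ici 0))
    {f : 𝓧 → ℝ} (hB2 : ∀ x y, ∫ z, (L₂ z.2 - L₂ y) ∂(κ (x, y)) ≤ f x + h (L₂ y))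
    {N : ℝ} (hN : 0 ≤ N) (z : 𝓧 × 𝓨) :
    -(U + h 0) ≤ f z.1 ∧
    ∫⁻ z', ENNReal.ofReal (L₂ z'.2) ∂κ z + ENNReal.ofReal (U + h 0) ≤
      ENNReal.ofReal (L₂ z.2) + (ENNReal.ofReal (min (f z.1) U + (U + h 0)) +
        (ENNReal.ofReal (h N) + ENNReal.ofReal (h 0) *
          {z : 𝓧 × 𝓨 | L₂ z.2 < N}.indicator (fun _ => 1) z)) := by
  obtain ⟨x, y⟩ := z
  have hm : Measurable fun z' : 𝓧 × 𝓨 => L₂ z'.2 := hL₂.comp measurable_snd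
  -- Makes the Bochner integral in `hB2` a true mean, not the default 0.
  have hint : Integrable (fun z' : 𝓧 × 𝓨 => L₂ z'.2 - L₂ y) (κ (x, y)) := by
    refine ⟨(hm.sub_const _).aestronglyMeasurable, ?_⟩
    rw [hasFiniteIntegral_iff_norm]
    exact (hB1 x y).trans_lt ENNReal.coe_lt_top
  have hintL : Integrable (fun z' : 𝓧 × 𝓨 => L₂ z'.2) (κ (x, y)) := by
    exact (hint.add (integrable_const (L₂ y))).congr (ae_of_all _ fun z' => by simp)
  set I := ∫ z', (L₂ z'.2 - L₂ y) ∂κ (x, y) with hI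
  have hIL : ∫ z', L₂ z'.2 ∂κ (x, y) = L₂ y + I := by
    rw [hI, integral_sub hintL (integrable_const _)]
    simp
  have hIabs : |I| ≤ U := by
    have h1 : |I| ≤ ∫ z', |L₂ z'.2 - L₂ y| ∂κ (x, y) := abs_integral_le_integral_abs
    refine h1.trans ?_
    rw [integral_eq_lintegral_of_nonneg_ae (ae_of_all _ fun _ => abs_nonneg _)
      (hm.sub_const _).abs.aestronglyMeasurable]
    exact ENNReal.toReal_le_coe_of_le_coe (hB1 x y)
  have h0 : 0 ≤ h 0 := h_nonneg 0 le_rfl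
  have hy0 : h (L₂ y) ≤ h 0 := h_anti (Set.mem_Ici.2 le_rfl) (hL₂_nonneg y) (hL₂_nonneg y)
  have hIle : I ≤ f x + h (L₂ y) := hB2 x y
  have hf : -(U + h 0) ≤ f x := by linarith [neg_le_of_abs_le hIabs]
  refine ⟨hf, ?_⟩
  have hU : (0 : ℝ) ≤ U := U.2
  have hmin : 0 ≤ min (f x) U + (U + h 0) := by
    rcases min_choice (f x) (U : ℝ) with e | e <;> rw [e] <;> linarith
  have hIL0 : 0 ≤ L₂ y + I := hIL ▸ integral_nonneg fun z' => hL₂_nonneg z'.2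
  rw [← ofReal_integral_eq_lintegral_ofReal hintL (ae_of_all _ fun z' => hL₂_nonneg z'.2), hIL]
  have hH : ∃ H : ℝ, 0 ≤ H ∧ h (L₂ y) ≤ H ∧ ENNReal.ofReal H ≤ ENNReal.ofReal (h N) +
      ENNReal.ofReal (h 0) * {z : 𝓧 × 𝓨 | L₂ z.2 < N}.indicator (fun _ => 1) (x, y) := by
    by_cases hyN : L₂ y < N
    · refine ⟨h 0, h0, hy0, ?_⟩
      rw [Set.indicator_of_mem (show (x, y) ∈ {z : 𝓧 × 𝓨 | L₂ z.2 < N} from hyN), mul_one]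
      exact le_add_self
    · exact ⟨h N, h_nonneg N hN, h_anti hN (hL₂_nonneg y) (not_lt.1 hyN), le_self_add⟩
  obtain ⟨H, hH0, hH1, hH2⟩ := hH
  refine le_trans ?_ (add_le_add_right (add_le_add_right hH2 _) _)
  rw [← ENNReal.ofReal_add hIL0 (by positivity), ← ENNReal.ofReal_add hmin hH0,
    ← ENNReal.ofReal_add (hL₂_nonneg y) (by positivity)]
  refine ENNReal.ofReal_le_ofReal ?_
  -- Where `f` is truncated, `hB1` itself bounds the mean increment by `U`.
  rcases min_choice (f x) (U : ℝ) with e | e <;> rw [e]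
  · linarith
  · linarith [le_of_abs_le hIabs]

end Autonomous

/-! ### The Lyapunov function on the product space -/

theorem theorem1 {𝓧 𝓨 : Type*}
    [MeasurableSpace 𝓧] [MeasurableSpace.CountablyGenerated 𝓧]
    [MeasurableSpace 𝓨] [MeasurableSpace.CountablyGenerated 𝓨]
    -- the transition kernel of the chain `(X^t, Y^t)`
    (κ : Kernel (𝓧 × 𝓨) (𝓧 × 𝓨)) [IsMarkovKernel κ]
    -- the transition kernel of the autonomous chain `X^t`
    (κX : Kernel 𝓧 𝓧) [IsMarkovKernel κX]
    (hA0 : ∀ x y, (κ (x, y)).map Prod.fst = κX x)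
    (hA1 : IsAperiodicKernel κX)
    (V : Set 𝓧)
    (hA2 : IsPositiveRecurrentSet κX V)
    (hA3 : HasMinorant κX V)
    (L₂ : 𝓨 → ℝ) (hL₂ : Measurable L₂) (hL₂_nonneg : ∀ y, 0 ≤ L₂ y)
    (U : ℝ≥0)
    (hB1 : ∀ x y, ∫⁻ z, ENNReal.ofReal |L₂ z.2 - L₂ y| ∂(κ (x, y)) ≤ U)
    (h : ℝ → ℝ) (h_nonneg : ∀ N, 0 ≤ N → 0 ≤ h N) (h_anti : AntitoneOn h (Set.Ici 0))
    (h_lim : Tendsto h atTop (𝓝 0))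
    (f : 𝓧 → ℝ) (hf : Measurable f)
    -- the mean of `f` under the stationary distribution of `X` is negative; that a stationary
    -- distribution exists and is unique is not assumed
    (hf_mean : ∀ π : Measure 𝓧, IsProbabilityMeasure π → Kernel.Invariant κX π →
      Integrable f π ∧ ∫ x, f x ∂π < 0)
    (hB2 : ∀ x y, ∫ z, (L₂ z.2 - L₂ y) ∂(κ (x, y)) ≤ f x + h (L₂ y)) :
    ∃ N₀ : ℝ, IsPositiveRecurrentSet κ (V ×ˢ {y | L₂ y ≤ N₀}) := by
  have hV := hA2.measurableSet
  obtain ⟨-, hVτ, b, hb⟩ := isPositiveRecurrentSet_iff.1 hA2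
  have hVne : V.Nonempty := by
    obtain ⟨p, μ, m, -, -, hμ, -⟩ := hA3
    obtain ⟨x⟩ := μ.nonempty_of_neZero
    by_contra hne
    rw [Set.not_nonempty_iff_eq_empty] at hne
    have := hVτ x
    simp [hne, survival_empty] at this
  rcases isEmpty_or_nonempty 𝓨 with hY | hY
  · exact ⟨0, isPositiveRecurrentSet_iff.2 ⟨hV.prod (measurableSet_le hL₂ measurable_const),
      fun z => (hY.false z.2).elim, 0, fun z => (hY.false z.2).elim⟩⟩
  obtain ⟨y₀⟩ := hY
  set w : 𝓧 → ℝ≥0∞ := Vᶜ.indicator (meanReturn κX V) with hw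
  set v : 𝓧 → ℝ≥0∞ := V.indicator (meanReturn κX V) with hv
  have hwm : Measurable w := (measurable_meanReturn hV).indicator hV.compl
  have hvm : Measurable v := (measurable_meanReturn hV).indicator hV
  have hwv : ∀ x, ∫⁻ z, w z ∂κX x + 1 = w x + v x := lintegral_indicator_compl_meanReturn hV
  have hvb : ∀ x, v x ≤ V.indicator (fun _ => (b : ℝ≥0∞)) x := by
    intro x
    by_cases hx : x ∈ V
    · simpa [hv, hx] using hb x hx
    · simp [hv, hx]
  have hw0 : ∀ x ∈ V, w x = 0 := fun x hx => by simp [hw, hx]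
  obtain ⟨π, hπ, hinv, herg⟩ := exists_invariant_uniform_average_le κX hV hVne hwm
    (fun x => (hwv x).le.trans (add_le_add_right (hvb x) _)) hw0 hA3
  have h0 : 0 ≤ h 0 := h_nonneg 0 le_rfl
  have hU : (0 : ℝ) ≤ U := U.2
  have hfM : ∀ x, -(U + h 0) ≤ f x := fun x =>
    (lintegral_drift_le hL₂ hL₂_nonneg hB1 h_nonneg h_anti hB2 le_rfl (x, y₀)).1
  set F : 𝓧 → ℝ≥0∞ := fun x => ENNReal.ofReal (min (f x) U + (U + h 0)) with hF
  have hFm : Measurable F := ((hf.min measurable_const).add_const _).ennreal_ofReal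
  have hFb : ∀ x, F x ≤ (U + (U + h 0)).toNNReal := fun x =>
    ENNReal.ofReal_le_ofReal (add_le_add_left (min_le_right _ _) _)
  -- A quarter of the negative drift: one `c` each for the averaging error, for `h N` and for visits
  -- below level `N`; the last is the net decrease.
  obtain ⟨c, hc, hFπ⟩ : ∃ c : ℝ≥0, 0 < c ∧
      ∫⁻ x, F x ∂π + 4 * c = ENNReal.ofReal (U + h 0) := by
    obtain ⟨hfi, hfneg⟩ := hf_mean π hπ hinv
    have hgi : Integrable (fun x => min (f x) (U : ℝ)) π := hfi.inf (integrable_const _)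
    have hle : ∫ x, min (f x) (U : ℝ) ∂π ≤ ∫ x, f x ∂π :=
      integral_mono hgi hfi fun x => min_le_left _ _
    have hF0 : ∀ x, 0 ≤ min (f x) U + (U + h 0) := fun x => by
      rcases min_choice (f x) (U : ℝ) with e | e <;> rw [e] <;> linarith [hfM x]
    have hgi' : Integrable (fun x => min (f x) U + (U + h 0)) π := hgi.add (integrable_const _)
    have hFint : ∫⁻ x, F x ∂π = ENNReal.ofReal (∫ x, min (f x) (U : ℝ) ∂π + (U + h 0)) := by
      rw [← ofReal_integral_eq_lintegral_ofReal hgi' (ae_of_all _ hF0),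
        integral_add hgi (integrable_const _)]
      simp
    have hnn : 0 ≤ ∫ x, min (f x) (U : ℝ) ∂π + (U + h 0) := by
      have := integral_nonneg (μ := π) (Pi.le_def.2 hF0)
      rw [integral_add hgi (integrable_const _)] at this
      simpa using this
    refine ⟨(-(∫ x, min (f x) (U : ℝ) ∂π) / 4).toNNReal, Real.toNNReal_pos.2 (by linarith), ?_⟩
    rw [hFint, ← ENNReal.ofReal, ← ENNReal.ofReal_ofNat, ← ENNReal.ofReal_mul (by norm_num),
      ← ENNReal.ofReal_add hnn (by linarith)]
    congr 1
    ring
  set A : ℝ≥0 := 2 / c with hA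
  set C : ℝ≥0 := 1 + A * U with hC
  have hAc : (A : ℝ≥0∞) * c = 2 := by
    rw [← ENNReal.coe_mul, hA, div_mul_cancel₀ _ hc.ne']
    simp
  have hCpos : 0 < C := by positivity
  have hCC : (C : ℝ≥0∞) * (C⁻¹ : ℝ≥0) = 1 := by
    rw [← ENNReal.coe_mul, mul_inv_cancel₀ hCpos.ne', ENNReal.coe_one]
  obtain ⟨n₁, hn₁⟩ := herg F _ c hFm hFb hc
  obtain ⟨n₂, hn₂⟩ := herg v b C⁻¹ hvm
    (fun x => (hvb x).trans (Set.indicator_le_self _ _ x)) (inv_pos.2 hCpos)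
  obtain ⟨k, hk₁, hk₂⟩ : ∃ k, n₁ ≤ k + 1 ∧ n₂ ≤ k + 1 :=
    ⟨max n₁ n₂, by omega, by omega⟩
  set n : ℕ := k + 1 with hn
  have hn0 : (n : ℝ≥0∞) ≠ ∞ := ENNReal.natCast_ne_top n
  -- Iterating `hwv` bounds `n + E w(X^n)` by the expected sum of `v`, which is at most `n * (1 +
  -- C⁻¹)` by averaging and Kac's bound.
  have hwn : ∀ x ∈ V, ∫⁻ z, w z ∂(κX ^ n) x ≤ n * (C⁻¹ : ℝ≥0) := by
    intro x hx
    have h1 := iterate_drift_le hwm measurable_const (fun x => (hwv x).le) n x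
    rw [expectedSum_const, mul_one, hw0 x hx, zero_add, add_comm] at h1
    refine (ENNReal.add_le_add_iff_left hn0).1 (h1.trans ((hn₂ n hk₂ x hx).trans ?_))
    rw [mul_add]
    gcongr
    exact mul_le_of_le_one_right' (lintegral_indicator_meanReturn_le_one hV π hinv)
  obtain ⟨N, hN0, hhN⟩ : ∃ N, 0 ≤ N ∧ h N ≤ c := by
    have h1 := h_lim.eventually (ge_mem_nhds (show (0 : ℝ) < c from hc))
    exact ((eventually_ge_atTop 0).and h1).exists
  -- Chosen so that visits below `N` cost at most `n * c`; `N₀` uses `R + 1` so that the divisor is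
  -- nonzero.
  set R : ℝ≥0 := (h 0).toNNReal * (n * U) / c with hR
  have hRc : ENNReal.ofReal (h 0) * (n * U) = c * R := by
    rw [hR, ← ENNReal.coe_mul, mul_div_cancel₀ _ hc.ne']
    push_cast
    rfl
  set N₀ : ℝ := N + (R + 1 : ℝ≥0) with hN₀
  set ℓ : 𝓧 × 𝓨 → ℝ≥0∞ := fun z => ENNReal.ofReal (L₂ z.2) with hℓ
  have hℓm : Measurable ℓ := (hL₂.comp measurable_snd).ennreal_ofReal
  have hE : MeasurableSet {z : 𝓧 × 𝓨 | L₂ z.2 < N} :=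
    measurableSet_lt (hL₂.comp measurable_snd) measurable_const
  have hLn : ∀ (t : ℕ) z, ∫⁻ z', ℓ z' ∂(κ ^ t) z ≤ ℓ z + t * U := by
    intro t z
    simpa [hℓ, abs_of_nonneg (hL₂_nonneg _)] using lintegral_abs_sub_le hL₂ hB1 t z 0
  have hfar : ∀ z : 𝓧 × 𝓨, z.1 ∈ V → N₀ ≤ L₂ z.2 →
      ∫⁻ z', ℓ z' ∂(κ ^ n) z + n * c ≤ ℓ z := by
    intro z hzV hz
    set s := expectedSum κ ({z : 𝓧 × 𝓨 | L₂ z.2 < N}.indicator fun _ => 1) n z with hs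
    have hs1 : ENNReal.ofReal (h 0) * s ≤ n * c := by
      have h1 : ((R + 1 : ℝ≥0) : ℝ≥0∞) * s ≤ n * (n * U) := by
        have := expectedSum_lt_le hL₂ hB1 n z hz
        rwa [ENNReal.ofReal_coe_nnreal] at this
      have hR0 : ((R + 1 : ℝ≥0) : ℝ≥0∞) ≠ 0 := by
        rw [ENNReal.coe_ne_zero]
        positivity
      refine (ENNReal.mul_le_mul_iff_right hR0 ENNReal.coe_ne_top).1 ?_
      calc ((R + 1 : ℝ≥0) : ℝ≥0∞) * (ENNReal.ofReal (h 0) * s)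
          = ENNReal.ofReal (h 0) * (((R + 1 : ℝ≥0) : ℝ≥0∞) * s) := by ring
        _ ≤ ENNReal.ofReal (h 0) * (n * (n * U)) := by gcongr
        _ = n * (ENNReal.ofReal (h 0) * (n * U)) := by ring
        _ = R * (n * c) := by rw [hRc]; ring
        _ ≤ _ := by
          gcongr
          exact le_self_add
    have hfm' : Measurable fun z : 𝓧 × 𝓨 => F z.1 := hFm.comp measurable_fst
    have hdrift := iterate_drift_le hℓm measurable_const (fun z =>
      (lintegral_drift_le hL₂ hL₂_nonneg hB1 h_nonneg h_anti hB2 hN0 z).2) n z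
    rw [expectedSum_const, expectedSum_add hfm', expectedSum_add measurable_const,
      expectedSum_const, expectedSum_const_mul (measurable_const.indicator hE),
      expectedSum_fst_of_autonomous hA0 n hFm, ← hFπ, ← hs] at hdrift
    have hIF : ∫⁻ x, F x ∂π ≠ ∞ := ne_top_of_le_ne_top ENNReal.ofReal_ne_top
      (hFπ ▸ le_self_add)
    have hfin : (n * ∫⁻ x, F x ∂π + 3 * (n * c) : ℝ≥0∞) ≠ ∞ :=
      ENNReal.add_ne_top.2 ⟨ENNReal.mul_ne_top hn0 hIF,
        ENNReal.mul_ne_top ENNReal.ofNat_ne_top (ENNReal.mul_ne_top hn0 ENNReal.coe_ne_top)⟩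
    refine (ENNReal.add_le_add_iff_right hfin).1 ?_
    have hhN' : ENNReal.ofReal (h N) ≤ c := by
      rw [← ENNReal.ofReal_coe_nnreal]
      exact ENNReal.ofReal_le_ofReal hhN
    calc ∫⁻ z', ℓ z' ∂(κ ^ n) z + n * c + (n * ∫⁻ x, F x ∂π + 3 * (n * c))
        = ∫⁻ z', ℓ z' ∂(κ ^ n) z + n * (∫⁻ x, F x ∂π + 4 * c) := by ring
      _ ≤ _ := hdrift
      _ ≤ ℓ z + (n * (∫⁻ x, F x ∂π + c) + (n * c + n * c)) := by
        gcongr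
        exact hn₁ n hk₁ z.1 hzV
      _ = _ := by ring
  have hD : MeasurableSet (V ×ˢ {y | L₂ y ≤ N₀}) :=
    hV.prod (measurableSet_le hL₂ measurable_const)
  set D : Set (𝓧 × 𝓨) := V ×ˢ {y | L₂ y ≤ N₀} with hDdef
  set b₁ : ℝ≥0 := n + A * (N₀.toNNReal + n * U) + n with hb₁
  set G : 𝓧 × 𝓨 → ℝ≥0∞ := fun z => A * ℓ z + C * w z.1 + D.indicator (fun _ => (b₁ : ℝ≥0∞)) z
    with hG
  have hwm' : Measurable fun z : 𝓧 × 𝓨 => w z.1 := hwm.comp measurable_fst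
  have hGint : ∀ (t : ℕ) z, ∫⁻ z' in Dᶜ, G z' ∂(κ ^ t) z ≤
      A * ∫⁻ z', ℓ z' ∂(κ ^ t) z + C * ∫⁻ x, w x ∂(κX ^ t) z.1 := by
    intro t z
    rw [← lintegral_pow_fst_of_autonomous hA0 t hwm, ← lintegral_const_mul _ hℓm,
      ← lintegral_const_mul _ hwm', ← lintegral_add_left (hℓm.const_mul _),
      ← lintegral_indicator hD.compl]
    refine lintegral_mono fun z' => ?_
    by_cases hz' : z' ∈ D <;> simp [hG, hz']
  have hret : ∀ z, meanReturn κ D z ≤ G z := by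
    classical
    -- The criterion adds one to the step count: `n = k + 1` steps on `V`, one step off it.
    refine meanReturn_le_of_drift hD (fun z => if z.1 ∈ V then k else 0) fun z => ?_
    by_cases hzV : z.1 ∈ V
    · simp only [if_pos hzV, ← hn]
      refine (add_le_add_right (hGint n z) _).trans ?_
      have hCw : (C : ℝ≥0∞) * ∫⁻ x, w x ∂(κX ^ n) z.1 ≤ n := by
        calc _ ≤ (C : ℝ≥0∞) * (n * (C⁻¹ : ℝ≥0)) := by gcongr; exact hwn _ hzV
          _ = n * (C * (C⁻¹ : ℝ≥0)) := by ring
          _ = n := by rw [hCC, mul_one]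
      by_cases hzN : L₂ z.2 ≤ N₀
      · have hzD : z ∈ D := ⟨hzV, hzN⟩
        calc _ ≤ (n : ℝ≥0∞) + (A * (ℓ z + n * U) + n) := by
              gcongr
              exact hLn n z
          _ ≤ (n : ℝ≥0∞) + (A * (ENNReal.ofReal N₀ + n * U) + n) := by
              gcongr
              exact ENNReal.ofReal_le_ofReal hzN
          _ = b₁ := by
              rw [hb₁]
              push_cast
              rw [add_assoc]
              rfl
          _ ≤ G z := by
              simp only [hG, Set.indicator_of_mem hzD]
              exact le_add_self
      · calc _ ≤ (n : ℝ≥0∞) + (A * ∫⁻ z', ℓ z' ∂(κ ^ n) z + n) := by gcongr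
          _ = A * ∫⁻ z', ℓ z' ∂(κ ^ n) z + n * 2 := by ring
          _ = A * (∫⁻ z', ℓ z' ∂(κ ^ n) z + n * c) := by rw [← hAc]; ring
          _ ≤ A * ℓ z := by
              gcongr
              exact hfar z hzV (not_le.1 hzN).le
          _ ≤ G z := by
              simp only [hG, add_assoc]
              exact le_self_add
    · simp only [if_neg hzV, zero_add]
      refine (add_le_add_right (hGint 1 z) _).trans ?_
      have hwz : ∫⁻ x, w x ∂(κX ^ 1) z.1 + 1 = w z.1 := by
        rw [pow_one, hwv]
        simp [hv, hzV]
      calc _ ≤ ((1 : ℕ) : ℝ≥0∞) + (A * (ℓ z + (1 : ℕ) * U) +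
            C * ∫⁻ x, w x ∂(κX ^ 1) z.1) := by
            gcongr
            exact hLn 1 z
        _ = A * ℓ z + C * (∫⁻ x, w x ∂(κX ^ 1) z.1 + 1) := by
            rw [hC]
            push_cast
            ring
        _ ≤ G z := by
            rw [hwz]
            exact le_self_add
  have hN₀0 : 0 ≤ N₀ := by positivity
  refine ⟨N₀, isPositiveRecurrentSet_iff.2 ⟨hD, ?_, A * N₀.toNNReal + b₁, fun z hz => ?_⟩⟩
  -- `G` may be infinite off `V`, where only almost sure return to `V` is known; it is finite over
  -- `V`, and that suffices.
  · refine iInf_survival_eq_zero_of_autonomous hA0 hV hVτ hD fun z hz => ?_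
    refine iInf_survival_eq_zero_of_meanReturn_ne_top (ne_top_of_le_ne_top ?_ (hret z))
    simp only [hG, hw0 _ hz, mul_zero, add_zero]
    refine ENNReal.add_ne_top.2 ⟨ENNReal.mul_ne_top ENNReal.coe_ne_top ENNReal.ofReal_ne_top,
      ne_top_of_le_ne_top ENNReal.coe_ne_top (Set.indicator_le_self _ _ z)⟩
  · refine (hret z).trans ?_
    simp only [hG, hw0 _ hz.1, mul_zero, add_zero]
    push_cast
    gcongr
    · exact ENNReal.ofReal_le_ofReal hz.2
    · exact Set.indicator_le_self _ _ z
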